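/- Let $n\ge 1$, let $\mathbb F_n^+$ be the free semigroup with unit $g_0$ on generators $g_1,\dots,g_n$, with length $|\alpha|$, and for operators $X_1,\dots,X_n$ write $X_\alpha=X_{i_1}\cdots X_{i_k}$ if $\alpha=g_{i_1}\cdots g_{i_k}$, and $X_{g_0}=I$. Let $f=\sum_{|\alpha|\ge1}a_\alpha X_\alpha$ be a positive regular free holomorphic function: $a_\alpha\ge0$, $a_{g_0}=0$, $a_{g_i}>0$ for all $i$, and $\limsup_k\big(\sum_{|\alpha|=k}a_\alpha^2\big)^{1/2k}<\infty$. Put $b_{g_0}=1$ and $$b_\alpha=\sum_{j=1}^{|\alpha|}\ \sum_{\gamma_1\cdots\gamma_j=\alpha,\ |\gamma_i|\ge1}a_{\gamma_1}\cdots a_{\gamma_j}\qquad(|\alpha|\ge1).$$ Let $F^2(H_n)$ be the full Fock space with orthonormal basis $(e_\alpha)_{\alpha\in\mathbb F_n^+}$, and let $W_ie_\alpha=\sqrt{b_\alpha/b_{g_i\alpha}}\;e_{g_i\alpha}$. The Hardy algebra $F_n^\infty(\mathcal D_f)$ is the algebra of all bounded operators $g$ on $F^2(H_n)$ for which there are $c_\beta\in\mathbb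 C$ with $\sum_\beta|c_\beta|^2/b_\beta<\infty$ and $gp=\sum_\beta c_\beta W_\beta p$ for every polynomial $p$ (finite linear combination of the $e_\alpha$); one writes $g=\sum_\beta c_\beta W_\beta$. For a Hilbert space $\mathcal H$ let $\mathcal D_f(\mathcal H)$ be the set of $n$-tuples $T=(T_1,\dots,T_n)$ in $B(\mathcal H)^n$ such that $\sum_{|\alpha|\ge1}a_\alpha T_\alpha T_\alpha^*$ converges in the weak operator topology to an operator of norm at most $1$. For such $T$ let $\Phi_{f,T}(X)=\sum_{|\alpha|\ge1}a_\alpha T_\alpha XT_\alpha^*$ (WOT convergence), $\Delta_{f,T}=(I-\Phi_{f,T}(I))^{1/2}$, and let $K_{f,T}:\mathcal H\to F^2(H_n)\otimes\mathcal H$, $K_{f,T}h=\sum_\alpha\sqrt{b_\alpha}\,e_\alpha\otimes\Delta_{f,T}T_\alpha^*h$, be the Poisson kernel. $T$ is completely non-coisometric (c.n.c.) if no $h\ne0$ satisfies $\langle\Phi_{f,T}^m(I)h,h\rangle=\|h\|^2$ for all $m\ge1$, and pure (of class $C_{\cdot0}$) if $\Phi_{f,T}^m(I)\to0$ strongly as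 $m\to\infty$. **Theorem.** Let $T\in\mathcal D_f(\mathcal H)$ be completely non-coisometric. For $g=\sum_\beta c_\beta W_\beta\in F_n^\infty(\mathcal D_f)$ and $0\le r<1$ the series $g_r(T)=\sum_{k\ge0}\sum_{|\alpha|=k}c_\alpha r^{k}T_\alpha$ (summed over $k$) converges in norm, and $$g(T):=\text{SOT-}\lim_{r\to1^-}g_r(T)$$ exists. The map $\Phi:F_n^\infty(\mathcal D_f)\to B(\mathcal H)$, $\Phi(g)=g(T)$, has the following properties. 1. $\Phi$ is WOT-continuous on bounded sets and SOT-continuous on bounded sets. 2. $\Phi$ is a unital completely contractive algebra homomorphism. 3. $\Phi$ coincides with the Poisson transform: $\Phi(g)=\text{SOT-}\lim_{r\to1^-}K_{f,rT}^*(g\otimes I_{\mathcal H})K_{f,rT}$ for every $g$. If, in addition, $T$ is pure, then $\Phi(g)=K_{f,T}^*(g\otimes I_{\mathcal H})K_{f,T}$ for every $g\in F_n^\infty(\mathcal D_f)$, $\Phi$ is $w^*$-continuous, and $g(T)^*=\text{SOT-}\lim_{r\to1^-}g_r(T)^*$ for every $g$. -/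

import Mathlib

open Filter Topology
open scoped ENNReal TensorProduct

noncomputable section

namespace NCDomain

/-- Words in `n` letters: the unital free semigroup on `n` generators. -/
abbrev Word (n : ℕ) : Type := FreeMonoid (Fin n)

instance (n : ℕ) : DecidableEq (Word n) := inferInstanceAs (DecidableEq (List (Fin n)))

/-- The word `g_{α 0} g_{α 1} ⋯ g_{α (k-1)}` of length `k`. -/
def wordOf {n k : ℕ} (α : Fin k → Fin n) : Word n := FreeMonoid.ofList (List.ofFn α)

/-- A positive regular free holomorphic function `f = ∑_α a_α X_α` in `n` noncommuting variables,
given by its coefficients. -/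
structure PositiveRegular (n : ℕ) where
  coeff : Word n → ℝ
  coeff_nonneg : ∀ α, 0 ≤ coeff α
  coeff_one : coeff 1 = 0
  coeff_of_pos : ∀ i, 0 < coeff (FreeMonoid.of i)
  limsup_lt_top : limsup (fun k : ℕ => ENNReal.ofReal
    ((∑ α : Fin k → Fin n, coeff (wordOf α) ^ 2) ^ (1 / (2 * (k : ℝ))))) atTop < ⊤

/-- The ways to write `α` as a product `γ_1 ⋯ γ_j` of words of length at least one. -/
def factorizations {n : ℕ} (α : Word n) : Set (List (Word n)) :=
  {l | l.prod = α ∧ ∀ γ ∈ l, 1 ≤ γ.length}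

theorem length_prod_le {n : ℕ} (l : List (Word n)) (h : ∀ γ ∈ l, 1 ≤ γ.length) :
    l.length ≤ l.prod.length ∧ ∀ γ ∈ l, γ.length ≤ l.prod.length := by
  induction l with
  | nil => simp
  | cons x l ih =>
    obtain ⟨h1, h2⟩ := ih fun γ hγ => h γ (by simp [hγ])
    have hx := h x (by simp)
    rw [List.prod_cons, FreeMonoid.length_mul]
    refine ⟨by simp; omega, ?_⟩
    intro γ hγ
    rcases List.mem_cons.1 hγ with rfl | hγ
    · omega
    · have := h2 γ hγ; omega

theorem finite_length_le (n N : ℕ) : {α : Word n | α.length ≤ N}.Finite :=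
  List.finite_length_le (Fin n) N

theorem factorizations_finite {n : ℕ} (α : Word n) : (factorizations α).Finite := by
  let S := {β : Word n | β.length ≤ α.length}
  have : Finite S := finite_length_le n α.length
  refine ((List.finite_length_le S α.length).image (List.map Subtype.val)).subset ?_
  rintro l ⟨rfl, hl⟩
  obtain ⟨h1, h2⟩ := length_prod_le l hl
  exact ⟨l.attach.map fun x => ⟨x.1, h2 x.1 x.2⟩, by simpa using h1, by simp⟩

namespace PositiveRegular

variable {n : ℕ} (f : PositiveRegular n)

/-- `b_α = ∑_j ∑_{γ_1 ⋯ γ_j = α, |γ_i| ≥ 1} a_{γ_1} ⋯ a_{γ_j}`; for the empty word this is `1`. -/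
def b (α : Word n) : ℝ := ∑ l ∈ (factorizations_finite α).toFinset, (l.map f.coeff).prod

theorem term_nonneg (l : List (Word n)) : 0 ≤ (l.map f.coeff).prod :=
  List.prod_nonneg (by simpa using fun a _ => f.coeff_nonneg a)

theorem b_one : f.b 1 = 1 := by
  have : (factorizations_finite (1 : Word n)).toFinset = {[]} := by
    ext l
    simp only [Set.Finite.mem_toFinset, Finset.mem_singleton]
    constructor
    · rintro ⟨h, h'⟩
      have := (length_prod_le l h').1
      rw [h] at this
      simpa using this
    · rintro rfl
      simp [factorizations]
  simp [b, this]

theorem coeff_mul_b_le (β α : Word n) : f.coeff β * f.b α ≤ f.b (β * α) := by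
  by_cases hβ : β = 1
  · subst hβ
    rw [f.coeff_one, zero_mul]
    exact Finset.sum_nonneg fun l _ => f.term_nonneg l
  rw [b, b, Finset.mul_sum]
  have h1 : ∀ l ∈ (factorizations_finite α).toFinset, f.coeff β * (l.map f.coeff).prod =
      ((β :: l).map f.coeff).prod := by intros; simp
  rw [Finset.sum_congr rfl h1,
    ← Finset.sum_image (s := (factorizations_finite α).toFinset) (g := fun l => β :: l)
      (f := fun l => (l.map f.coeff).prod) (fun _ _ _ _ h => by simpa using h)]
  refine Finset.sum_le_sum_of_subset_of_nonneg ?_ fun l _ _ => f.term_nonneg l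
  intro l hl
  obtain ⟨l', hl', rfl⟩ := Finset.mem_image.1 hl
  obtain ⟨rfl, hl2⟩ := (Set.Finite.mem_toFinset _).1 hl'
  refine (Set.Finite.mem_toFinset _).2 ⟨by simp, ?_⟩
  intro γ hγ
  rcases List.mem_cons.1 hγ with rfl | hγ
  · exact Nat.one_le_iff_ne_zero.2 (by simpa using hβ)
  · exact hl2 γ hγ

theorem b_pos (α : Word n) : 0 < f.b α := by
  induction α using FreeMonoid.inductionOn' with
  | one => rw [b_one]; exact one_pos
  | of_mul i α ih => exact (mul_pos (f.coeff_of_pos i) ih).trans_le (f.coeff_mul_b_le _ _)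

end PositiveRegular

/-- The full Fock space `F²(H_n)`, realized as `ℓ²` of the free semigroup. -/
abbrev Fock (n : ℕ) : Type := lp (fun _ : Word n => ℂ) 2

/-- The orthonormal basis vector `e_α` of the full Fock space. -/
def e {n : ℕ} (α : Word n) : Fock n := lp.single 2 α (1 : ℂ)

theorem e_orthonormal (n : ℕ) : Orthonormal ℂ (e : Word n → Fock n) := by
  rw [orthonormal_iff_ite]
  intro α β
  rw [e, e, lp.inner_single_left, lp.single_apply]
  by_cases h : α = β
  · subst h; simp
  · rw [Pi.single_eq_of_ne h]; simp [h]

theorem e_mul_orthonormal {n : ℕ} (i : Fin n) :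
    Orthonormal ℂ (fun α : Word n => e (FreeMonoid.of i * α)) :=
  (e_orthonormal n).comp _ (mul_right_injective _)

/-- The left creation operator `S_i`, determined by `S_i e_α = e_{g_i α}`. -/
def creation {n : ℕ} (i : Fin n) : Fock n →L[ℂ] Fock n :=
  (e_mul_orthonormal i).orthogonalFamily.linearIsometry.toContinuousLinearMap

theorem creation_e {n : ℕ} (i : Fin n) (α : Word n) :
    creation i (e α) = e (FreeMonoid.of i * α) := by
  simp [creation, e, OrthogonalFamily.linearIsometry_apply_single]

namespace PositiveRegular

variable {n : ℕ} (f : PositiveRegular n)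

theorem sqrt_ratio_le (i : Fin n) (α : Word n) :
    ‖(((√(f.b α / f.b (FreeMonoid.of i * α)) : ℝ) : ℂ) • ContinuousLinearMap.id ℂ ℂ)‖ ≤
      √(1 / f.coeff (FreeMonoid.of i)) := by
  rw [norm_smul, ContinuousLinearMap.norm_id, mul_one, Complex.norm_real, Real.norm_eq_abs,
    abs_of_nonneg (Real.sqrt_nonneg _)]
  apply Real.sqrt_le_sqrt
  rw [div_le_div_iff₀ (f.b_pos _) (f.coeff_of_pos i), one_mul, mul_comm]
  exact f.coeff_mul_b_le _ _

/-- The diagonal operator `D_i e_α = √(b_α / b_{g_i α}) e_α`. -/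
def diag (i : Fin n) : Fock n →L[ℂ] Fock n :=
  lp.mapCLM 2 (fun α => ((√(f.b α / f.b (FreeMonoid.of i * α)) : ℝ) : ℂ) •
    ContinuousLinearMap.id ℂ ℂ) (Real.sqrt_nonneg _) (f.sqrt_ratio_le i)

/-- The weighted left creation operator `W_i = S_i D_i`. -/
def W (i : Fin n) : Fock n →L[ℂ] Fock n := creation i * f.diag i

theorem W_e (i : Fin n) (α : Word n) :
    f.W i (e α) = ((√(f.b α / f.b (FreeMonoid.of i * α)) : ℝ) : ℂ) • e (FreeMonoid.of i * α) := by
  have : f.diag i (e α) = ((√(f.b α / f.b (FreeMonoid.of i * α)) : ℝ) : ℂ) • e α := by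
    ext β
    by_cases h : β = α
    · subst h; rw [lp.coeFn_smul]; simp [diag, e, lp.mapCLM]
    · rw [lp.coeFn_smul]; simp [diag, e, lp.mapCLM, Pi.single_eq_of_ne h]
  rw [W, mul_apply_eq_comp, this, map_smul, creation_e]

end PositiveRegular

/-- `X_α = X_{i_1} ⋯ X_{i_k}` for `α = g_{i_1} ⋯ g_{i_k}`, and `X_α = I` for the empty word. -/
def wordProd {n : ℕ} {H : Type*} [NormedAddCommGroup H] [InnerProductSpace ℂ H]
    (X : Fin n → H →L[ℂ] H) (α : Word n) : H →L[ℂ] H := FreeMonoid.lift X α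

theorem wordProd_mul {n : ℕ} {H : Type*} [NormedAddCommGroup H] [InnerProductSpace ℂ H]
    (X : Fin n → H →L[ℂ] H) (α β : Word n) :
    wordProd X (α * β) = wordProd X α * wordProd X β := map_mul _ _ _

theorem wordProd_W_e {n : ℕ} (f : PositiveRegular n) (α γ : Word n) :
    wordProd f.W α (e γ) = ((√(f.b γ / f.b (α * γ)) : ℝ) : ℂ) • e (α * γ) := by
  induction α using FreeMonoid.inductionOn' with
  | one => simp [wordProd, div_self (f.b_pos γ).ne']
  | of_mul i α ih =>
    have h : wordProd f.W (FreeMonoid.of i) = f.W i := by simp [wordProd]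
    rw [wordProd_mul, mul_apply_eq_comp, ih, map_smul, h, f.W_e, smul_smul,
      ← Complex.ofReal_mul, ← Real.sqrt_mul (div_nonneg (f.b_pos _).le (f.b_pos _).le),
      div_mul_div_cancel₀ (f.b_pos _).ne', mul_assoc]


/-- The polynomials in the full Fock space: finite linear combinations of the `e_α`. -/
def polynomials (n : ℕ) : Submodule ℂ (Fock n) := Submodule.span ℂ (Set.range e)

/-- `A` is the operator `φ(W_1, …, W_n)` of the formal sum `φ = ∑_β c_β W_β`:
`∑_β |c_β|² / b_β < ∞` and `A p = ∑_β c_β W_β p` for every polynomial `p`. -/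
def HasFourier {n : ℕ} (f : PositiveRegular n) (c : Word n → ℂ) (A : Fock n →L[ℂ] Fock n) : Prop :=
  (Summable fun β => ‖c β‖ ^ 2 * (1 / f.b β)) ∧
    ∀ p ∈ polynomials n, HasSum (fun β => c β • wordProd f.W β p) (A p)

theorem hasFourier_mk {n : ℕ} {f : PositiveRegular n} {A : Fock n →L[ℂ] Fock n} {c : Word n → ℂ}
    (hc : ∀ γ α, (A (e γ)) (α * γ) = c α * (√(f.b γ / f.b (α * γ)) : ℝ))
    (h0 : ∀ γ δ, (∀ α, δ ≠ α * γ) → (A (e γ)) δ = 0) : HasFourier f c A := by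
  refine ⟨?_, fun p hp => ?_⟩
  · have h := (lp.memℓp (A (e 1))).summable (by norm_num)
    refine h.congr fun β => ?_
    have := hc 1 β
    rw [mul_one] at this
    rw [this, f.b_one]
    simp [mul_pow, Real.sq_sqrt (f.b_pos _).le]
  · induction hp using Submodule.span_induction with
    | mem p hp =>
      obtain ⟨γ, rfl⟩ := hp
      have h := lp.hasSum_single (p := 2) (by norm_num) (A (e γ))
      have hinj : Function.Injective (fun α : Word n => α * γ) := mul_left_injective γ
      rw [← hinj.hasSum_iff] at h
      · convert h using 2 with α
        simp only [Function.comp_apply]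
        rw [wordProd_W_e, hc, smul_smul, e, ← lp.single_smul, smul_eq_mul, mul_one]
      · intro δ hδ
        rw [h0 γ δ fun α hα => hδ ⟨α, hα.symm⟩, lp.single_zero]
    | zero => simp
    | add x y _ _ hx hy => simpa using hx.add hy
    | smul r x _ hx =>
      simpa [smul_comm r] using hx.const_smul r

theorem hasSum_of_eq {ι : Type*} {u v : ι → ℂ} {x : ℂ} (h : ∀ i, u i = v i) (hv : HasSum v x) :
    HasSum u x := (funext h : u = v) ▸ hv

theorem HasFourier.hasSum_apply {n : ℕ} {f : PositiveRegular n} {A : Fock n →L[ℂ] Fock n}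
    {c : Word n → ℂ} (h : HasFourier f c A) (γ δ : Word n) :
    HasSum (fun α => c α * ((√(f.b γ / f.b (α * γ)) : ℝ) * (e (α * γ) : Fock n) δ))
      ((A (e γ)) δ) := by
  have h1 := h.2 (e γ) (Submodule.subset_span ⟨γ, rfl⟩)
  have h2 := h1.mapL (lp.evalCLM ℂ (fun _ : Word n => ℂ) 2 δ)
  refine hasSum_of_eq (fun α => ?_) h2
  rw [wordProd_W_e, map_smul, map_smul, smul_eq_mul, smul_eq_mul]
  rfl

theorem HasFourier.apply_mul {n : ℕ} {f : PositiveRegular n} {A : Fock n →L[ℂ] Fock n}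
    {c : Word n → ℂ} (h : HasFourier f c A) (γ α : Word n) :
    (A (e γ)) (α * γ) = c α * (√(f.b γ / f.b (α * γ)) : ℝ) := by
  refine (h.hasSum_apply γ (α * γ)).unique ?_
  convert hasSum_single α ?_ using 1
  · simp [e]
  · intro β hβ
    rw [e, lp.single_apply_ne]
    · simp
    · exact fun h => hβ (mul_right_cancel h).symm

theorem HasFourier.apply_eq_zero {n : ℕ} {f : PositiveRegular n} {A : Fock n →L[ℂ] Fock n}
    {c : Word n → ℂ} (h : HasFourier f c A) (γ δ : Word n) (hδ : ∀ α, δ ≠ α * γ) :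
    (A (e γ)) δ = 0 := by
  refine (h.hasSum_apply γ δ).unique ?_
  convert hasSum_zero with α
  rw [e, lp.single_apply_ne _ _ _ (hδ α)]
  simp

theorem hasFourier_one {n : ℕ} (f : PositiveRegular n) :
    HasFourier f (Pi.single 1 1) 1 := by
  refine hasFourier_mk (fun γ α => ?_) fun γ δ h => ?_
  · by_cases hα : α = 1
    · subst hα
      simp [e, div_self (f.b_pos γ).ne']
    · rw [one_apply_eq_self, e, lp.single_apply_ne, Pi.single_eq_of_ne hα, zero_mul]
      exact fun h => hα (by simpa using h)
  · rw [one_apply_eq_self, e, lp.single_apply_ne]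
    simpa using h 1

theorem HasFourier.add {n : ℕ} {f : PositiveRegular n} {A B : Fock n →L[ℂ] Fock n}
    {c d : Word n → ℂ} (hA : HasFourier f c A) (hB : HasFourier f d B) :
    HasFourier f (c + d) (A + B) := by
  refine hasFourier_mk (fun γ α => ?_) fun γ δ h => ?_
  · simp [hA.apply_mul, hB.apply_mul, add_mul]
  · simp [hA.apply_eq_zero γ δ h, hB.apply_eq_zero γ δ h]

theorem HasFourier.smul {n : ℕ} {f : PositiveRegular n} {A : Fock n →L[ℂ] Fock n}
    {c : Word n → ℂ} (hA : HasFourier f c A) (r : ℂ) : HasFourier f (r • c) (r • A) := by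
  refine hasFourier_mk (fun γ α => ?_) fun γ δ h => ?_
  · simp [hA.apply_mul, mul_assoc]
  · simp [hA.apply_eq_zero γ δ h]

theorem HasFourier.mul {n : ℕ} {f : PositiveRegular n} {A B : Fock n →L[ℂ] Fock n}
    {c d : Word n → ℂ} (hA : HasFourier f c A) (hB : HasFourier f d B) :
    ∃ k, HasFourier f k (A * B) := by
  have key : ∀ γ δ, HasSum
      (fun β => d β * ((√(f.b γ / f.b (β * γ)) : ℝ) * (A (e (β * γ))) δ)) ((A (B (e γ))) δ) := by
    intro γ δ
    have h1 := hB.2 (e γ) (Submodule.subset_span ⟨γ, rfl⟩)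
    have h2 := (h1.mapL A).mapL (lp.evalCLM ℂ (fun _ : Word n => ℂ) 2 δ)
    refine hasSum_of_eq (fun α => ?_) h2
    rw [wordProd_W_e, map_smul, map_smul, map_smul, map_smul, smul_eq_mul, smul_eq_mul]
    rfl
  refine ⟨fun α => (A (B (e 1))) α * (√(f.b α) : ℝ), hasFourier_mk (fun γ α => ?_)
    fun γ δ h => ?_⟩
  · refine (key γ (α * γ)).unique ?_
    have h1 := (key 1 α).mul_right (((√(f.b α) : ℝ) : ℂ) * (√(f.b γ / f.b (α * γ)) : ℝ))
    rw [← mul_assoc] at h1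
    refine hasSum_of_eq (fun β => ?_) h1
    by_cases hβ : ∃ ω, α = ω * β
    · obtain ⟨ω, rfl⟩ := hβ
      have e1 := hA.apply_mul (β * γ) ω
      have e2 := hA.apply_mul β ω
      rw [mul_one, mul_assoc ω β γ, e1, e2, f.b_one]
      have p1 := f.b_pos γ
      have p2 := f.b_pos (β * γ)
      have p3 := f.b_pos (ω * (β * γ))
      have p4 := f.b_pos β
      have p5 := f.b_pos (ω * β)
      have e3 : √(f.b γ / f.b (β * γ)) * √(f.b (β * γ) / f.b (ω * (β * γ))) =
          √(1 / f.b β) * √(f.b β / f.b (ω * β)) * (√(f.b (ω * β)) *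
            √(f.b γ / f.b (ω * (β * γ)))) := by
        rw [← Real.sqrt_mul (by positivity), ← Real.sqrt_mul (by positivity),
          ← Real.sqrt_mul (by positivity), ← Real.sqrt_mul (by positivity)]
        congr 1
        field_simp
      have e4 := congrArg (fun x : ℝ => (x : ℂ)) e3
      push_cast at e4
      linear_combination d β * c ω * e4
    · push Not at hβ
      rw [mul_one, hA.apply_eq_zero β α hβ, hA.apply_eq_zero (β * γ) (α * γ)]
      · simp
      · intro ω h
        rw [← mul_assoc] at h
        exact hβ ω (mul_right_cancel h)
  · refine (key γ δ).unique ?_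
    convert hasSum_zero with β
    rw [hA.apply_eq_zero (β * γ) δ fun ω => by rw [← mul_assoc]; exact h (ω * β)]
    simp

/-- The Hardy algebra `F_n^∞(𝒟_f)`: all bounded operators `φ(W_1, …, W_n)` on the full Fock space
given by formal sums `φ = ∑_β c_β W_β`. -/
def hardyAlgebra {n : ℕ} (f : PositiveRegular n) : Subalgebra ℂ (Fock n →L[ℂ] Fock n) where
  carrier := {A | ∃ c, HasFourier f c A}
  mul_mem' := fun ⟨_, h⟩ ⟨_, h'⟩ => h.mul h'
  add_mem' := fun ⟨_, h⟩ ⟨_, h'⟩ => ⟨_, h.add h'⟩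
  algebraMap_mem' r := by
    rw [Algebra.algebraMap_eq_smul_one]
    exact ⟨_, (hasFourier_one f).smul r⟩


section Domain

variable {n : ℕ} {H : Type*} [NormedAddCommGroup H] [InnerProductSpace ℂ H] [CompleteSpace H]

/-- The terms `a_α T_α X T_α^*`, seen in `B(H)` with the weak operator topology. -/
def phiTerm (f : PositiveRegular n) (T : Fin n → H →L[ℂ] H) (X : H →L[ℂ] H) (α : Word n) :
    H →WOT[ℂ] H :=
  ContinuousLinearMapWOT.ofCLM
    ((f.coeff α : ℂ) • (wordProd T α * X * ContinuousLinearMap.adjoint (wordProd T α)))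

/-- `Φ_{f,T}(X) = ∑_{|α| ≥ 1} a_α T_α X T_α^*`, the series converging in the weak operator
topology. -/
def phi (f : PositiveRegular n) (T : Fin n → H →L[ℂ] H) (X : H →L[ℂ] H) : H →L[ℂ] H :=
  ContinuousLinearMapWOT.toCLM (∑' α, phiTerm f T X α)

/-- The noncommutative domain `𝒟_f(H)`: the `n`-tuples `T` for which `∑_{|α| ≥ 1} a_α T_α T_α^*`
converges in the weak operator topology to an operator of norm at most one. -/
def domain (f : PositiveRegular n) (H : Type*) [NormedAddCommGroup H] [InnerProductSpace ℂ H]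
    [CompleteSpace H] : Set (Fin n → H →L[ℂ] H) :=
  {T | Summable (phiTerm f T 1) ∧ ‖phi f T 1‖ ≤ 1}

/-- `T` is completely non-coisometric with respect to `𝒟_f(H)`. -/
def IsCNC (f : PositiveRegular n) (T : Fin n → H →L[ℂ] H) : Prop :=
  ¬ ∃ h : H, h ≠ 0 ∧ ∀ m : ℕ, 1 ≤ m → inner ℂ ((phi f T)^[m] 1 h) h = ((‖h‖ ^ 2 : ℝ) : ℂ)

/-- `T` is of class `C_{·0}` (pure): `Φ_{f,T}^m(I) → 0` in the strong operator topology. -/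
def IsPure (f : PositiveRegular n) (T : Fin n → H →L[ℂ] H) : Prop :=
  ∀ h : H, Tendsto (fun m : ℕ => (phi f T)^[m] 1 h) atTop (𝓝 0)

/-- `Δ_{f,T} = (I - Φ_{f,T}(I))^{1/2}`. -/
def defect (f : PositiveRegular n) (T : Fin n → H →L[ℂ] H) : H →L[ℂ] H :=
  CFC.sqrt (1 - phi f T 1)

/-- The Hilbert space tensor product `F²(H_n) ⊗ H`. -/
abbrev FockTensor (n : ℕ) (H : Type*) [NormedAddCommGroup H] [InnerProductSpace ℂ H] : Type _ :=
  UniformSpace.Completion (Fock n ⊗[ℂ] H)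

/-- The elementary tensor `x ⊗ h` in `F²(H_n) ⊗ H`. -/
def tensor (x : Fock n) (h : H) : FockTensor n H := ((x ⊗ₜ[ℂ] h : Fock n ⊗[ℂ] H) : FockTensor n H)

/-- The operator `g ⊗ I_H` on `F²(H_n) ⊗ H`. -/
def ampliation (H : Type*) [NormedAddCommGroup H] [InnerProductSpace ℂ H]
    (g : Fock n →L[ℂ] Fock n) : FockTensor n H →L[ℂ] FockTensor n H :=
  (g.rTensor H).completion

theorem ampliation_tensor (K : Type*) [NormedAddCommGroup K] [InnerProductSpace ℂ K]
    (g : Fock n →L[ℂ] Fock n) (x : Fock n) (h : K) :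
    ampliation K g (tensor x h) = tensor (g x) h := by
  rw [ampliation, tensor, ContinuousLinearMap.completion_apply_coe,
    ContinuousLinearMap.rTensor_tmul, tensor]

/-- The isometry `h ↦ e_α ⊗ h`. -/
def basisTensor (H : Type*) [NormedAddCommGroup H] [InnerProductSpace ℂ H] (α : Word n) :
    H →ₗᵢ[ℂ] FockTensor n H where
  toFun h := tensor (e α) h
  map_add' x y := by simp [tensor, TensorProduct.tmul_add, UniformSpace.Completion.coe_add]
  map_smul' r x := by simp [tensor, TensorProduct.tmul_smul, UniformSpace.Completion.coe_smul]
  norm_map' x := by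
    have : ‖(e α : Fock n)‖ = 1 := (e_orthonormal n).1 α
    simp [tensor, this]

theorem basisTensor_orthogonal (H : Type*) [NormedAddCommGroup H] [InnerProductSpace ℂ H] :
    OrthogonalFamily ℂ (fun _ : Word n => H) (basisTensor H) := by
  intro α β hαβ x y
  change inner ℂ (tensor (e α) x) (tensor (e β) y) = 0
  rw [tensor, tensor, UniformSpace.Completion.inner_coe, TensorProduct.inner_tmul,
    (e_orthonormal n).2 hαβ, zero_mul]

theorem hasSum_phi {f : PositiveRegular n} {T : Fin n → H →L[ℂ] H} (hT : T ∈ domain f H) (x : H) :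
    HasSum (fun α => f.coeff α * ‖ContinuousLinearMap.adjoint (wordProd T α) x‖ ^ 2)
      (inner ℂ x (phi f T 1 x)).re ∧ (inner ℂ x (phi f T 1 x)).im = 0 := by
  have h1 : HasSum (phiTerm f T 1) (∑' α, phiTerm f T 1 α) := hT.1.hasSum
  have h2 := (ContinuousLinearMapWOT.tendsto_iff_forall_inner_apply_tendsto.1 h1) x x
  have h3 : HasSum (fun α => ((f.coeff α *
      ‖ContinuousLinearMap.adjoint (wordProd T α) x‖ ^ 2 : ℝ) : ℂ)) (inner ℂ x (phi f T 1 x)) := by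
    refine Tendsto.congr (fun s => ?_) h2
    have h4 : ∀ s : Finset (Word n), inner ℂ x ((∑ α ∈ s, phiTerm f T 1 α) x) =
        ∑ α ∈ s, inner ℂ x (phiTerm f T 1 α x) := by
      intro s
      induction s using Finset.induction_on with
      | empty => simp
      | insert a s ha ih => rw [Finset.sum_insert ha, Finset.sum_insert ha, ← ih,
          ContinuousLinearMapWOT.add_apply, inner_add_right]
    rw [h4]
    refine Finset.sum_congr rfl fun α _ => ?_
    rw [phiTerm, ContinuousLinearMapWOT.ofCLM_apply]
    simp only [mul_one, smul_apply, mul_apply_eq_comp]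
    rw [inner_smul_right, ← ContinuousLinearMap.adjoint_inner_left, inner_self_eq_norm_sq_to_K]
    push_cast
    rfl
  refine ⟨by simpa only [Complex.ofReal_re] using Complex.hasSum_re h3, ?_⟩
  have h5 := Complex.hasSum_im h3
  simp only [Complex.ofReal_im] at h5
  exact h5.unique hasSum_zero

theorem norm_defect_sq {f : PositiveRegular n} {T : Fin n → H →L[ℂ] H} (hT : T ∈ domain f H)
    (x : H) : ‖defect f T x‖ ^ 2 = ‖x‖ ^ 2 - (inner ℂ x (phi f T 1 x)).re := by
  have hpos : 0 ≤ 1 - phi f T 1 := by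
    rw [ContinuousLinearMap.nonneg_iff_isPositive, ContinuousLinearMap.isPositive_iff_complex]
    intro y
    have hi := (hasSum_phi hT y).2
    have hb : ‖inner ℂ y (phi f T 1 y)‖ ≤ ‖y‖ ^ 2 :=
      calc ‖inner ℂ y (phi f T 1 y)‖ ≤ ‖y‖ * ‖phi f T 1 y‖ := norm_inner_le_norm _ _
        _ ≤ ‖y‖ * (1 * ‖y‖) := by gcongr; exact ContinuousLinearMap.le_of_opNorm_le _ hT.2 y
        _ = ‖y‖ ^ 2 := by ring
    have hre := (Complex.re_le_norm _).trans hb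
    have e1 : inner ℂ ((1 - phi f T 1) y) y =
        ((‖y‖ ^ 2 - (inner ℂ y (phi f T 1 y)).re : ℝ) : ℂ) := by
      have e0 : inner ℂ y ((1 - phi f T 1) y) =
          ((‖y‖ ^ 2 - (inner ℂ y (phi f T 1 y)).re : ℝ) : ℂ) := by
        rw [sub_apply, one_apply_eq_self, inner_sub_right, inner_self_eq_norm_sq_to_K]
        apply Complex.ext
        · simp [← Complex.ofReal_pow]
        · simp [hi, ← Complex.ofReal_pow]
      rw [← inner_conj_symm, e0, Complex.conj_ofReal]
    rw [e1]
    exact ⟨rfl, sub_nonneg.2 hre⟩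
  have hsq : defect f T * defect f T = 1 - phi f T 1 := CFC.sqrt_mul_sqrt_self _ hpos
  have hsa : ContinuousLinearMap.adjoint (defect f T) = defect f T :=
    (IsSelfAdjoint.of_nonneg (CFC.sqrt_nonneg (1 - phi f T 1))).adjoint_eq
  have h2 : (inner ℂ x ((defect f T * defect f T) x)).re = ‖defect f T x‖ ^ 2 := by
    rw [mul_apply_eq_comp, ← ContinuousLinearMap.adjoint_inner_left, hsa,
      inner_self_eq_norm_sq_to_K]
    simp [← Complex.ofReal_pow]
  rw [← h2, hsq, sub_apply, inner_sub_right, one_apply_eq_self,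
    inner_self_eq_norm_sq_to_K]
  simp [← Complex.ofReal_pow]

theorem PositiveRegular.b_le_sum (f : PositiveRegular n) {δ : Word n} (hδ : δ ≠ 1)
    (F : Finset (Word n)) (hF : ∀ γ : Word n, γ.length ≤ δ.length → γ ∈ F) :
    f.b δ ≤ ∑ p ∈ (F ×ˢ F).filter (fun p => p.1 * p.2 = δ), f.b p.1 * f.coeff p.2 := by
  classical
  have h1 : ∀ p ∈ (F ×ˢ F).filter (fun p => p.1 * p.2 = δ), f.b p.1 * f.coeff p.2 =
      ∑ l ∈ (factorizations_finite p.1).toFinset, ((l ++ [p.2]).map f.coeff).prod := by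
    intro p _
    rw [PositiveRegular.b, Finset.sum_mul]
    simp
  rw [Finset.sum_congr rfl h1, Finset.sum_sigma']
  rw [← Finset.sum_image (f := fun l : List (Word n) => (l.map f.coeff).prod)
    (g := fun x : (_ : Word n × Word n) × List (Word n) => x.2 ++ [x.1.2])]
  · refine Finset.sum_le_sum_of_subset_of_nonneg ?_ fun l _ _ => f.term_nonneg l
    intro l hl
    obtain ⟨rfl, hl2⟩ := (Set.Finite.mem_toFinset _).1 hl
    clear hl
    rcases List.eq_nil_or_concat l with rfl | ⟨l, β, rfl⟩
    · simp at hδ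
    · refine Finset.mem_image.2 ⟨⟨(l.prod, β), l⟩, ?_, by simp⟩
      have hlen : (l ++ [β]).prod.length = l.prod.length + β.length := by simp
      simp only [Finset.mem_sigma, Finset.mem_filter, Finset.mem_product, Set.Finite.mem_toFinset]
      simp only [List.concat_eq_append] at hF hl2 ⊢
      refine ⟨⟨⟨hF _ (by omega), hF _ (by omega)⟩, by simp⟩, rfl, fun γ hγ => hl2 γ (by simp [hγ])⟩
  · rintro ⟨⟨p, q⟩, l⟩ hx ⟨⟨p', q'⟩, l'⟩ hx' h
    simp only [Finset.coe_sigma, Set.mem_sigma_iff, Finset.mem_coe, Set.Finite.mem_toFinset]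
      at hx hx'
    obtain ⟨rfl, h2⟩ := List.append_inj' h rfl
    obtain ⟨-, ⟨rfl, -⟩⟩ := hx
    obtain ⟨-, ⟨rfl, -⟩⟩ := hx'
    simp only [List.cons.injEq, and_true] at h2
    subst h2
    rfl

theorem sum_defect_le {f : PositiveRegular n} {T : Fin n → H →L[ℂ] H} (hT : T ∈ domain f H)
    (h : H) (s : Finset (Word n)) :
    ∑ α ∈ s, f.b α * ‖defect f T (ContinuousLinearMap.adjoint (wordProd T α) h)‖ ^ 2 ≤ ‖h‖ ^ 2 := by
  classical
  set p : Word n → ℝ := fun α => ‖ContinuousLinearMap.adjoint (wordProd T α) h‖ ^ 2 with hp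
  have hp0 : ∀ α, 0 ≤ p α := fun α => by positivity
  obtain ⟨N, hN⟩ : ∃ N, ∀ α ∈ s, α.length ≤ N := ⟨s.sup FreeMonoid.length, fun α hα =>
    Finset.le_sup (f := FreeMonoid.length) hα⟩
  let F : Finset (Word n) := (finite_length_le n N).toFinset
  have hF : ∀ α : Word n, α ∈ F ↔ α.length ≤ N := fun α => by simp [F]
  have h1 : ∀ γ, ‖defect f T (ContinuousLinearMap.adjoint (wordProd T γ) h)‖ ^ 2 ≤
      p γ - ∑ β ∈ F, f.coeff β * p (γ * β) := by
    intro γ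
    rw [norm_defect_sq hT]
    refine sub_le_sub_left ?_ _
    have h2 := sum_le_hasSum F (fun α _ => mul_nonneg (f.coeff_nonneg α) (sq_nonneg _))
      (hasSum_phi hT (ContinuousLinearMap.adjoint (wordProd T γ) h)).1
    refine le_trans (le_of_eq (Finset.sum_congr rfl fun β _ => ?_)) h2
    have : ContinuousLinearMap.adjoint (wordProd T (γ * β)) h =
        ContinuousLinearMap.adjoint (wordProd T β)
          (ContinuousLinearMap.adjoint (wordProd T γ) h) := by
      rw [wordProd_mul, ← ContinuousLinearMap.star_eq_adjoint, star_mul]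
      rfl
    rw [hp]
    simp only [this]
  have hsub : s ⊆ F := fun α hα => (hF α).2 (hN α hα)
  have h3 : ∑ δ ∈ F.erase 1, f.b δ * p δ ≤
      ∑ x ∈ F ×ˢ F, f.b x.1 * f.coeff x.2 * p (x.1 * x.2) := by
    calc ∑ δ ∈ F.erase 1, f.b δ * p δ
        ≤ ∑ δ ∈ F.erase 1, ∑ x ∈ (F ×ˢ F).filter (fun x => x.1 * x.2 = δ),
            f.b x.1 * f.coeff x.2 * p (x.1 * x.2) := by
          refine Finset.sum_le_sum fun δ hδ => ?_
          obtain ⟨hδ1, hδF⟩ := Finset.mem_erase.1 hδ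
          have h4 := f.b_le_sum hδ1 F fun γ hγ => (hF γ).2 (hγ.trans ((hF δ).1 hδF))
          refine (mul_le_mul_of_nonneg_right h4 (hp0 δ)).trans (le_of_eq ?_)
          rw [Finset.sum_mul]
          refine Finset.sum_congr rfl fun x hx => ?_
          rw [(Finset.mem_filter.1 hx).2]
      _ ≤ _ := by
          refine Finset.sum_fiberwise_le_sum_of_sum_fiber_nonneg fun y _ => ?_
          exact Finset.sum_nonneg fun x _ =>
            mul_nonneg (mul_nonneg (f.b_pos _).le (f.coeff_nonneg _)) (hp0 _)
  have h1F : (1 : Word n) ∈ F := (hF 1).2 (by simp)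
  calc ∑ α ∈ s, f.b α * ‖defect f T (ContinuousLinearMap.adjoint (wordProd T α) h)‖ ^ 2
      ≤ ∑ α ∈ F, f.b α * ‖defect f T (ContinuousLinearMap.adjoint (wordProd T α) h)‖ ^ 2 :=
        Finset.sum_le_sum_of_subset_of_nonneg hsub fun α _ _ =>
          mul_nonneg (f.b_pos α).le (sq_nonneg _)
    _ ≤ ∑ γ ∈ F, f.b γ * (p γ - ∑ β ∈ F, f.coeff β * p (γ * β)) :=
        Finset.sum_le_sum fun γ _ => mul_le_mul_of_nonneg_left (h1 γ) (f.b_pos γ).le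
    _ = ∑ γ ∈ F, f.b γ * p γ - ∑ x ∈ F ×ˢ F, f.b x.1 * f.coeff x.2 * p (x.1 * x.2) := by
        rw [Finset.sum_product, ← Finset.sum_sub_distrib]
        refine Finset.sum_congr rfl fun γ _ => ?_
        rw [mul_sub, Finset.mul_sum]
        congr 1
        exact Finset.sum_congr rfl fun β _ => by ring
    _ ≤ ∑ γ ∈ F, f.b γ * p γ - ∑ δ ∈ F.erase 1, f.b δ * p δ := sub_le_sub_left h3 _
    _ = f.b 1 * p 1 := by rw [← Finset.add_sum_erase F _ h1F]; ring
    _ = ‖h‖ ^ 2 := by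
        rw [f.b_one, one_mul]
        simp [hp, wordProd, ← ContinuousLinearMap.star_eq_adjoint]

/-- The sequence `(√b_α Δ_{f,T} T_α^* h)_α`. -/
def kernelCoord (f : PositiveRegular n) (T : Fin n → H →L[ℂ] H) (h : H) (α : Word n) : H :=
  ((√(f.b α) : ℝ) : ℂ) • defect f T (ContinuousLinearMap.adjoint (wordProd T α) h)

theorem sum_kernelCoord_le {f : PositiveRegular n} {T : Fin n → H →L[ℂ] H} (hT : T ∈ domain f H)
    (h : H) (s : Finset (Word n)) :
    ∑ α ∈ s, ‖kernelCoord f T h α‖ ^ (2 : ℝ≥0∞).toReal ≤ ‖h‖ ^ 2 := by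
  refine le_trans (le_of_eq (Finset.sum_congr rfl fun α _ => ?_)) (sum_defect_le hT h s)
  rw [kernelCoord, norm_smul, Complex.norm_real, Real.norm_eq_abs, abs_of_nonneg (Real.sqrt_nonneg _)]
  simp [mul_pow, Real.sq_sqrt (f.b_pos α).le]

/-- For `T ∈ 𝒟_f(H)`, the contraction `h ↦ (√b_α Δ_{f,T} T_α^* h)_α` into `ℓ²`. -/
def kernelSeq (f : PositiveRegular n) (T : Fin n → H →L[ℂ] H) (hT : T ∈ domain f H) :
    H →L[ℂ] lp (fun _ : Word n => H) 2 :=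
  LinearMap.mkContinuous
    { toFun := fun h => ⟨kernelCoord f T h, memℓp_gen' (sum_kernelCoord_le hT h)⟩
      map_add' := fun x y => by
        ext α
        change kernelCoord f T (x + y) α = kernelCoord f T x α + kernelCoord f T y α
        simp [kernelCoord]
      map_smul' := fun r x => by
        ext α
        change kernelCoord f T (r • x) α = r • kernelCoord f T x α
        simp only [kernelCoord, map_smul, smul_comm r] }
    1 fun h => by
      refine lp.norm_le_of_forall_sum_le (by norm_num) (by positivity) fun s => ?_
      simpa using sum_kernelCoord_le hT h s

open Classical in
/-- The Poisson kernel `K_{f,T} h = ∑_α √b_α e_α ⊗ Δ_{f,T} T_α^* h` of `T ∈ 𝒟_f(H)`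
(and `0` for other tuples). -/
def poissonKernel (f : PositiveRegular n) (T : Fin n → H →L[ℂ] H) : H →L[ℂ] FockTensor n H :=
  if hT : T ∈ domain f H then
    (basisTensor_orthogonal H).linearIsometry.toContinuousLinearMap ∘L kernelSeq f T hT
  else 0

theorem hasSum_poissonKernel {f : PositiveRegular n} {T : Fin n → H →L[ℂ] H} (hT : T ∈ domain f H)
    (h : H) : HasSum (fun α => ((√(f.b α) : ℝ) : ℂ) •
      tensor (e α) (defect f T (ContinuousLinearMap.adjoint (wordProd T α) h)))
      (poissonKernel f T h) := by
  rw [poissonKernel, dif_pos hT]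
  have h1 := (basisTensor_orthogonal H).hasSum_linearIsometry (kernelSeq f T hT h)
  have h2 : ∀ α, basisTensor H α (kernelCoord f T h α) = ((√(f.b α) : ℝ) : ℂ) •
      tensor (e α) (defect f T (ContinuousLinearMap.adjoint (wordProd T α) h)) := fun α => by
    rw [kernelCoord, map_smul]
    rfl
  simp only [← h2]
  exact h1

end Domain

/-- `g_r(T_1, …, T_n) = ∑_k ∑_{|α| = k} c_α r^{|α|} T_α` for the formal sum `g = ∑_α c_α W_α`, the
outer series converging in norm. -/
def dilation {n : ℕ} {H : Type*} [NormedAddCommGroup H] [InnerProductSpace ℂ H]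
    (c : Word n → ℂ) (r : ℝ) (T : Fin n → H →L[ℂ] H) : H →L[ℂ] H :=
  ∑' k : ℕ, ∑ α : Fin k → Fin n, (c (wordOf α) * (r : ℂ) ^ k) • wordProd T (wordOf α)

section Topologies

variable (E : Type*) [NormedAddCommGroup E] [InnerProductSpace ℂ E]

/-- The weak operator topology on `B(E)`. -/
def wot : TopologicalSpace (E →L[ℂ] E) :=
  TopologicalSpace.induced (fun A => (ContinuousLinearMapWOT.ofCLM A : E →WOT[ℂ] E)) inferInstance

/-- The strong operator topology on `B(E)`. -/
def sot : TopologicalSpace (E →L[ℂ] E) :=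
  TopologicalSpace.induced (fun (A : E →L[ℂ] E) (x : E) => A x) inferInstance

/-- The `w*`-topology (ultraweak topology) on `B(E)`: the coarsest topology for which the
functionals `A ↦ ∑_k ⟨A x_k, y_k⟩`, with `∑_k ‖x_k‖² < ∞` and `∑_k ‖y_k‖² < ∞`, are continuous. -/
def weakStar : TopologicalSpace (E →L[ℂ] E) :=
  ⨅ (x : lp (fun _ : ℕ => E) 2) (y : lp (fun _ : ℕ => E) 2),
    TopologicalSpace.induced (fun A : E →L[ℂ] E => ∑' k, inner ℂ (y k) (A (x k))) inferInstance

end Topologies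

/-- The operator on the direct sum `E^(m)` of `m` copies of `E` given by an `m × m` matrix of
operators on `E`. -/
def blockOp {E : Type*} [NormedAddCommGroup E] [InnerProductSpace ℂ E] {m : ℕ}
    (A : Matrix (Fin m) (Fin m) (E →L[ℂ] E)) :
    PiLp 2 (fun _ : Fin m => E) →L[ℂ] PiLp 2 (fun _ : Fin m => E) :=
  (PiLp.continuousLinearEquiv 2 ℂ (fun _ : Fin m => E)).symm.toContinuousLinearMap ∘L
    ContinuousLinearMap.pi fun i => ∑ j, A i j ∘L PiLp.proj 2 (fun _ : Fin m => E) j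

end NCDomain

end

/-! Everything rests on one intertwining relation. Write K_S for the Poisson kernel of S. Its
adjoint sends e_γ ⊗ x to √b_γ S_γ Δ_S x, and the weights of W_α are such that K_S^*(W_α ⊗ I) = S_α
K_S^* (`adjoint_poissonKernel_tensor_e`, `HasFourier.hasSum_adjoint_poissonKernel`). With S = rT,
summing against the Fourier coefficients of g gives g_r(T) K_{rT}^* = K_{rT}^*(g ⊗ I).

For r < 1 the tuple rT is pure, because Φ_{rT}^m(I) has norm at most r^{2m}, and the kernel of a
pure tuple is an isometry (`norm_poissonKernel_of_isPure`). Hence g_r(T) = K_{rT}^*(g ⊗ I)K_{rT} and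
‖g_r(T)‖ ≤ ‖g‖ (`HasFourier.dilation_eq`). The same formula, applied entrywise to matrices, gives
complete contractivity in the limit.

As r → 1, K_{rT}^* → K_T^* strongly (`tendsto_adjoint_poissonKernel_smul`), so g_r(T) K_T^* ξ →
K_T^*(g ⊗ I)ξ for every ξ. A completely non-coisometric T has an injective K_T, so K_T^* has dense
range, and with the uniform bound the strong limit g(T) exists on all of H. It is the only operator
with g(T) K_T^* = K_T^*(g ⊗ I) (`eq_of_comp_adjoint_eq`). This yields linearity and
multiplicativity, and reduces WOT- and SOT-continuity on bounded sets to that of g ↦ g ⊗ I.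

If T is pure, K_T is itself an isometry, so g(T) = K_T^*(g ⊗ I)K_T. Slicing F² ⊗ H along a Hilbert
basis of H turns w*-functionals of g ⊗ I into w*-functionals of g. In this case K_{rT} → K_T
strongly as well, which gives the convergence of the adjoints. -/

namespace NCDomain
open ContinuousLinearMap (adjoint)

section

/-! ### Strong limits of bounded families of operators. -/

section StrongLimits

variable {ι E F : Type*} [NormedAddCommGroup E] [NormedSpace ℂ E] [NormedAddCommGroup F]
  [NormedSpace ℂ F] {l : Filter ι} {A : ι → E →L[ℂ] F} {C : ℝ} {s : Set E}

theorem tendsto_apply_apply {B : E →L[ℂ] F} {x : ι → E} {y : E} (hC : ∀ᶠ i in l, ‖A i‖ ≤ C)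
    (hA : Tendsto (fun i => A i y) l (𝓝 (B y))) (hx : Tendsto x l (𝓝 y)) :
    Tendsto (fun i => A i (x i)) l (𝓝 (B y)) := by
  have h1 : Tendsto (fun i => A i (x i - y)) l (𝓝 0) := by
    have h2 : Tendsto (fun i => C * ‖x i - y‖) l (𝓝 0) := by
      simpa using (tendsto_iff_norm_sub_tendsto_zero.1 hx).const_mul C
    exact squeeze_zero_norm' (hC.mono fun i hi => (A i).le_of_opNorm_le hi _) h2
  simpa using h1.add hA

variable [CompleteSpace F]

theorem exists_tendsto_apply_of_dense_span [l.NeBot] (hC : ∀ᶠ i in l, ‖A i‖ ≤ C)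
    (hs : Dense (Submodule.span ℂ s : Set E)) (h : ∀ x ∈ s, ∃ y, Tendsto (fun i => A i x) l (𝓝 y)) :
    ∃ B : E →L[ℂ] F, ∀ x, Tendsto (fun i => A i x) l (𝓝 (B x)) := by
  have hC0 : 0 ≤ C := by
    obtain ⟨i, hi⟩ := hC.exists
    exact (norm_nonneg _).trans hi
  have hspan : ∀ x ∈ Submodule.span ℂ s, ∃ y, Tendsto (fun i => A i x) l (𝓝 y) := by
    intro x hx
    induction hx using Submodule.span_induction with
    | mem x hx => exact h x hx
    | zero => exact ⟨0, by simp⟩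
    | add x y _ _ hx hy =>
      obtain ⟨a, ha⟩ := hx
      obtain ⟨b, hb⟩ := hy
      exact ⟨a + b, by simpa using ha.add hb⟩
    | smul r x _ hx =>
      obtain ⟨a, ha⟩ := hx
      exact ⟨r • a, by simpa using ha.const_smul r⟩
  have hall : ∀ x, ∃ y, Tendsto (fun i => A i x) l (𝓝 y) := by
    intro x
    refine cauchy_map_iff_exists_tendsto.1 (Metric.cauchy_iff.2 ⟨inferInstance, fun ε hε => ?_⟩)
    -- `C + 1` instead of `C` keeps the radius meaningful when `C = 0`.
    obtain ⟨z, hz, hxz⟩ := Metric.dense_iff.1 hs x (ε / (4 * (C + 1))) (by positivity)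
    obtain ⟨y, hy⟩ := hspan z hxz
    have hz : ‖z - x‖ < ε / (4 * (C + 1)) := by simpa [dist_eq_norm] using hz
    refine ⟨_, image_mem_map (hC.and (Metric.tendsto_nhds.1 hy (ε / 4) (by positivity))), ?_⟩
    have key : ∀ i, ‖A i‖ ≤ C → dist (A i z) y < ε / 4 → dist (A i x) y < ε / 2 := by
      intro i hi hi'
      have h1 : dist (A i x) (A i z) ≤ ε / 4 := by
        rw [dist_comm, dist_eq_norm, ← map_sub]
        calc ‖A i (z - x)‖ ≤ C * ‖z - x‖ := (A i).le_of_opNorm_le hi _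
          _ ≤ (C + 1) * (ε / (4 * (C + 1))) := by gcongr; linarith
          _ = ε / 4 := by field_simp
      linarith [dist_triangle (A i x) (A i z) y]
    rintro _ ⟨i, ⟨hi1, hi2⟩, rfl⟩ _ ⟨j, ⟨hj1, hj2⟩, rfl⟩
    linarith [dist_triangle_right (A i x) (A j x) y, key i hi1 hi2, key j hj1 hj2]
  choose B hB using hall
  refine ⟨LinearMap.mkContinuous
    { toFun := B
      map_add' := fun x y => tendsto_nhds_unique (hB (x + y)) (by simpa using (hB x).add (hB y))
      map_smul' := fun r x => tendsto_nhds_unique (hB (r • x))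
        (by simpa using (hB x).const_smul r) } C fun x => ?_, hB⟩
  exact le_of_tendsto (hB x).norm (hC.mono fun i hi => (A i).le_of_opNorm_le hi x)

theorem tendsto_apply_of_dense_span {B : E →L[ℂ] F} (hC : ∀ᶠ i in l, ‖A i‖ ≤ C)
    (hs : Dense (Submodule.span ℂ s : Set E))
    (h : ∀ x ∈ s, Tendsto (fun i => A i x) l (𝓝 (B x))) (x : E) :
    Tendsto (fun i => A i x) l (𝓝 (B x)) := by
  rcases l.eq_or_neBot with rfl | hl
  · exact tendsto_bot
  obtain ⟨B', hB'⟩ := exists_tendsto_apply_of_dense_span hC hs fun x hx => ⟨_, h x hx⟩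
  have : B = B' := ContinuousLinearMap.ext_on hs fun x hx =>
    tendsto_nhds_unique (h x hx) (hB' x)
  exact this ▸ hB' x

end StrongLimits

/-! ### Strong continuity of the square root on positive contractions. -/

section Sqrt

variable {ι H : Type*} [NormedAddCommGroup H] [InnerProductSpace ℂ H] {l : Filter ι}

/-- Multiplication is jointly strongly continuous on bounded sets, so polynomials pass to strong
limits. -/
theorem tendsto_aeval_apply {A : ι → H →L[ℂ] H} {B : H →L[ℂ] H} {C : ℝ}
    (hC : ∀ᶠ i in l, ‖A i‖ ≤ C) (h : ∀ x, Tendsto (fun i => A i x) l (𝓝 (B x)))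
    (p : Polynomial ℝ) (x : H) :
    Tendsto (fun i => Polynomial.aeval (A i) p x) l (𝓝 (Polynomial.aeval B p x)) := by
  induction p using Polynomial.induction_on generalizing x with
  | C a => simpa using tendsto_const_nhds
  | add p q hp hq => simpa using (hp x).add (hq x)
  | monomial k a ih =>
    have key : Polynomial.C a * Polynomial.X ^ (k + 1) =
        Polynomial.X * (Polynomial.C a * Polynomial.X ^ k) := by ring
    simp only [key, map_mul _ Polynomial.X, Polynomial.aeval_X, mul_apply_eq_comp]
    exact tendsto_apply_apply hC (h _) (ih x)

variable [CompleteSpace H]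

theorem norm_sqrt_sub_aeval_le {A : H →L[ℂ] H} (hA0 : 0 ≤ A) (hA1 : ‖A‖ ≤ 1) {p : Polynomial ℝ}
    {ε : ℝ} (hp : ∀ x ∈ Set.Icc (0 : ℝ) 1, |p.eval x - √x| < ε) :
    ‖Polynomial.aeval A p - CFC.sqrt A‖ ≤ ε := by
  have hε : 0 ≤ ε := (abs_nonneg _).trans (hp 0 (by simp)).le
  have hsa : IsSelfAdjoint A := .of_nonneg hA0
  rw [CFC.sqrt_eq_real_sqrt A hA0, cfcₙ_eq_cfc, ← cfc_polynomial p A, ← cfc_sub ..]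
  refine norm_cfc_le hε fun x hx => ?_
  have h0 : 0 ≤ x := spectrum_nonneg_of_nonneg hA0 hx
  have h1 : ‖x‖ ≤ 1 := (spectrum.norm_le_norm_mul_of_mem hx).trans (by
    -- The spectral bound carries a factor ‖1‖, which equals 1 only on a nontrivial space.
    rcases subsingleton_or_nontrivial H with hH | hH
    · have : A = 0 := Subsingleton.elim _ _
      simp [this]
    · simpa using hA1)
  exact (hp x ⟨h0, (le_abs_self x).trans h1⟩).le

/-- By Weierstrass, one polynomial approximates √ uniformly on [0, 1], hence approximates all the
square roots at once in operator norm; for that polynomial strong convergence is already known. -/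
theorem tendsto_sqrt_apply {A : ι → H →L[ℂ] H} {B : H →L[ℂ] H}
    (hA : ∀ᶠ i in l, 0 ≤ A i ∧ ‖A i‖ ≤ 1) (hB0 : 0 ≤ B) (hB1 : ‖B‖ ≤ 1)
    (h : ∀ x, Tendsto (fun i => A i x) l (𝓝 (B x))) (x : H) :
    Tendsto (fun i => CFC.sqrt (A i) x) l (𝓝 (CFC.sqrt B x)) := by
  rw [Metric.tendsto_nhds]
  intro ε hε
  obtain ⟨p, hp⟩ := exists_polynomial_near_of_continuousOn 0 1 Real.sqrt
    Real.continuous_sqrt.continuousOn (ε / (3 * (‖x‖ + 1))) (by positivity)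
  have key : ∀ D : H →L[ℂ] H, 0 ≤ D → ‖D‖ ≤ 1 →
      dist (Polynomial.aeval D p x) (CFC.sqrt D x) ≤ ε / 3 := by
    intro D h0 h1
    rw [dist_eq_norm]
    calc ‖(Polynomial.aeval D p - CFC.sqrt D) x‖ ≤ ε / (3 * (‖x‖ + 1)) * ‖x‖ :=
          ContinuousLinearMap.le_of_opNorm_le _ (norm_sqrt_sub_aeval_le h0 h1 hp) x
      _ ≤ ε / (3 * (‖x‖ + 1)) * (‖x‖ + 1) := by gcongr; linarith
      _ = ε / 3 := by field_simp
  filter_upwards [hA, Metric.tendsto_nhds.1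
    (tendsto_aeval_apply (hA.mono fun i hi => hi.2) h p x) (ε / 3) (by positivity)] with i hi hi'
  have h1 := key (A i) hi.1 hi.2
  have h2 := key B hB0 hB1
  have h4 := dist_triangle (CFC.sqrt (A i) x) (Polynomial.aeval (A i) p x) (CFC.sqrt B x)
  have h5 := dist_triangle (Polynomial.aeval (A i) p x) (Polynomial.aeval B p x) (CFC.sqrt B x)
  rw [dist_comm] at h1
  linarith

end Sqrt

end

/-! ### Row bounds, the map Φ, and radial scaling of the domain. -/

section

variable {n : ℕ} {H : Type*} [NormedAddCommGroup H] [InnerProductSpace ℂ H]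

theorem wordProd_one (T : Fin n → H →L[ℂ] H) : wordProd T 1 = 1 := map_one _

theorem wordProd_smul (c : ℂ) (T : Fin n → H →L[ℂ] H) (α : Word n) :
    wordProd (fun i => c • T i) α = c ^ α.length • wordProd T α := by
  induction α using FreeMonoid.inductionOn' with
  | one => simp [wordProd]
  | of_mul i α ih =>
    have h1 : ∀ X : Fin n → H →L[ℂ] H, wordProd X (FreeMonoid.of i) = X i := by simp [wordProd]
    rw [wordProd_mul, ih, wordProd_mul, h1, h1, FreeMonoid.length_mul, FreeMonoid.length_of,
      pow_add, pow_one, smul_mul_smul_comm]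

theorem inner_sum_wot (s : Finset (Word n)) (A : Word n → H →WOT[ℂ] H) (x y : H) :
    inner ℂ y ((∑ α ∈ s, A α) x) = ∑ α ∈ s, inner ℂ y (A α x) := by
  classical
  induction s using Finset.induction_on with
  | empty => simp
  | insert a s ha ih => rw [Finset.sum_insert ha, Finset.sum_insert ha, ← ih,
      ContinuousLinearMapWOT.add_apply, inner_add_right]

variable [CompleteSpace H]

theorem adjoint_wordProd_mul (T : Fin n → H →L[ℂ] H) (α β : Word n) (h : H) :
    adjoint (wordProd T (α * β)) h = adjoint (wordProd T β) (adjoint (wordProd T α) h) := by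
  rw [wordProd_mul, ← ContinuousLinearMap.star_eq_adjoint, star_mul]
  rfl

theorem norm_adjoint_wordProd_smul {r : ℝ} (hr : 0 ≤ r) (T : Fin n → H →L[ℂ] H) (α : Word n)
    (h : H) : ‖adjoint (wordProd (fun i => (r : ℂ) • T i) α) h‖ =
      r ^ α.length * ‖adjoint (wordProd T α) h‖ := by
  rw [wordProd_smul, map_smulₛₗ, smul_apply, norm_smul]
  simp [abs_of_nonneg hr]

/-- `∑_{|α| ≥ 1} a_α T_α T_α^* ≤ C I`, in terms of finite partial sums. -/
def RowBound (f : PositiveRegular n) (T : Fin n → H →L[ℂ] H) (C : ℝ) : Prop :=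
  ∀ (x : H) (s : Finset (Word n)),
    ∑ α ∈ s, f.coeff α * ‖adjoint (wordProd T α) x‖ ^ 2 ≤ C * ‖x‖ ^ 2

/-- The sequence `(√a_α T_α^* x)_α`. -/
noncomputable def rowCoord (f : PositiveRegular n) (T : Fin n → H →L[ℂ] H) (x : H) (α : Word n) :
    H := ((√(f.coeff α) : ℝ) : ℂ) • adjoint (wordProd T α) x

section RowBound

variable {f : PositiveRegular n} {T : Fin n → H →L[ℂ] H} {C : ℝ}

theorem RowBound.sum_rowCoord_le (hT : RowBound f T C) (x : H) (s : Finset (Word n)) :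
    ∑ α ∈ s, ‖rowCoord f T x α‖ ^ (2 : ℝ≥0∞).toReal ≤ C * ‖x‖ ^ 2 := by
  refine le_trans (le_of_eq (Finset.sum_congr rfl fun α _ => ?_)) (hT x s)
  rw [rowCoord, norm_smul, Complex.norm_real, Real.norm_eq_abs,
    abs_of_nonneg (Real.sqrt_nonneg _)]
  simp [mul_pow, Real.sq_sqrt (f.coeff_nonneg α)]

/-- The operator `x ↦ (√a_α T_α^* x)_α` into `ℓ²`. -/
noncomputable def rowSeq (hC : 0 ≤ C) (hT : RowBound f T C) : H →L[ℂ] lp (fun _ : Word n => H) 2 :=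
  LinearMap.mkContinuous
    { toFun := fun x => ⟨rowCoord f T x, memℓp_gen' (hT.sum_rowCoord_le x)⟩
      map_add' := fun x y => by
        ext α
        change rowCoord f T (x + y) α = rowCoord f T x α + rowCoord f T y α
        simp [rowCoord]
      map_smul' := fun r x => by
        ext α
        change rowCoord f T (r • x) α = r • rowCoord f T x α
        simp only [rowCoord, map_smul, smul_comm r] }
    √C fun x => by
      refine lp.norm_le_of_forall_sum_le (by norm_num) (by positivity) fun s => ?_
      simpa [mul_pow, Real.sq_sqrt hC] using hT.sum_rowCoord_le x s

theorem norm_rowSeq_le (hC : 0 ≤ C) (hT : RowBound f T C) : ‖rowSeq hC hT‖ ≤ √C :=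
  LinearMap.mkContinuous_norm_le _ (Real.sqrt_nonneg _) _

theorem inner_phiTerm (X : H →L[ℂ] H) (α : Word n) (x y : H) :
    inner ℂ y (phiTerm f T X α x) =
      f.coeff α * inner ℂ (adjoint (wordProd T α) y) (X (adjoint (wordProd T α) x)) := by
  rw [phiTerm, ContinuousLinearMapWOT.ofCLM_apply, smul_apply, inner_smul_right,
    mul_apply_eq_comp, mul_apply_eq_comp, ContinuousLinearMap.adjoint_inner_left]

/-- With V the row map x ↦ (√a_α T_α^* x)_α, the sum is V^*(⊕X)V: each matrix coefficient of the
series is an inner product in ℓ². This makes Φ(X) meaningful for every bounded X and gives ‖Φ(X)‖ ≤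
C‖X‖. -/
theorem RowBound.hasSum_phiTerm (hC : 0 ≤ C) (hT : RowBound f T C) (X : H →L[ℂ] H) :
    HasSum (phiTerm f T X) (ContinuousLinearMapWOT.ofCLM
      (adjoint (rowSeq hC hT) ∘L lp.mapCLM 2 (fun _ => X) (norm_nonneg X) (fun _ => le_rfl) ∘L
        rowSeq hC hT)) := by
  refine ContinuousLinearMapWOT.tendsto_iff_forall_inner_apply_tendsto.2 fun x y => ?_
  simp only [inner_sum_wot]
  change Tendsto _ _ (𝓝 (inner ℂ y (adjoint (rowSeq hC hT) (lp.mapCLM 2 (fun _ : Word n => X)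
    (norm_nonneg X) (fun _ => le_rfl) (rowSeq hC hT x)))))
  rw [ContinuousLinearMap.adjoint_inner_right]
  refine Tendsto.congr (fun s => ?_) (lp.hasSum_inner (𝕜 := ℂ) (rowSeq hC hT y) (lp.mapCLM 2
    (fun _ : Word n => X) (norm_nonneg X) (fun _ => le_rfl) (rowSeq hC hT x)))
  refine Finset.sum_congr rfl fun α _ => ?_
  have h1 : ∀ z, rowSeq hC hT z α = ((√(f.coeff α) : ℝ) : ℂ) • adjoint (wordProd T α) z :=
    fun _ => rfl
  rw [inner_phiTerm]
  simp only [lp.mapCLM_apply_coe, h1, map_smul, inner_smul_left, inner_smul_right,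
    Complex.conj_ofReal]
  rw [← mul_assoc, ← Complex.ofReal_mul, Real.mul_self_sqrt (f.coeff_nonneg α)]

theorem RowBound.norm_phi_le (hC : 0 ≤ C) (hT : RowBound f T C) (X : H →L[ℂ] H) :
    ‖phi f T X‖ ≤ C * ‖X‖ := by
  rw [phi, (hT.hasSum_phiTerm hC X).tsum_eq, ContinuousLinearMapWOT.toCLM_ofCLM]
  calc _ ≤ ‖adjoint (rowSeq hC hT)‖ * (‖lp.mapCLM 2 (fun _ : Word n => X) (norm_nonneg X)
        (fun _ => le_rfl)‖ * ‖rowSeq hC hT‖) :=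
        (ContinuousLinearMap.opNorm_comp_le _ _).trans
          (mul_le_mul_of_nonneg_left (ContinuousLinearMap.opNorm_comp_le _ _) (norm_nonneg _))
    _ ≤ √C * (‖X‖ * √C) := by
        have := norm_rowSeq_le hC hT
        rw [LinearIsometryEquiv.norm_map]
        gcongr
        exact lp.norm_mapCLM_le _ _ _ _
    _ = C * ‖X‖ := by linear_combination ‖X‖ * Real.mul_self_sqrt hC

/-- Together with `rowBound_of_mem_domain` this reduces membership in the domain to finite sums,
which is how scaled tuples are handled. -/
theorem RowBound.mem_domain (hC : 0 ≤ C) (hC1 : C ≤ 1) (hT : RowBound f T C) : T ∈ domain f H := by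
  refine ⟨(hT.hasSum_phiTerm hC 1).summable, (hT.norm_phi_le hC 1).trans ?_⟩
  calc C * ‖(1 : H →L[ℂ] H)‖ ≤ 1 * 1 := by gcongr; exact ContinuousLinearMap.norm_id_le
    _ = 1 := one_mul 1

theorem inner_phi_one_le (hT : T ∈ domain f H) (x : H) :
    (inner ℂ x (phi f T 1 x)).re ≤ ‖x‖ ^ 2 :=
  calc (inner ℂ x (phi f T 1 x)).re ≤ ‖x‖ * ‖phi f T 1 x‖ :=
        (Complex.re_le_norm _).trans (norm_inner_le_norm _ _)
    _ ≤ ‖x‖ * (1 * ‖x‖) := by gcongr; exact ContinuousLinearMap.le_of_opNorm_le _ hT.2 x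
    _ = ‖x‖ ^ 2 := by ring

theorem rowBound_of_mem_domain (hT : T ∈ domain f H) : RowBound f T 1 := fun x s => by
  rw [one_mul]
  exact (sum_le_hasSum s (fun α _ => mul_nonneg (f.coeff_nonneg α) (sq_nonneg _))
    (hasSum_phi hT x).1).trans (inner_phi_one_le hT x)

theorem hasSum_inner_phi (hT : T ∈ domain f H) (X : H →L[ℂ] H) (x y : H) :
    HasSum (fun α => f.coeff α *
      inner ℂ (adjoint (wordProd T α) y) (X (adjoint (wordProd T α) x)))
      (inner ℂ y (phi f T X x)) := by
  have h1 := ((rowBound_of_mem_domain hT).hasSum_phiTerm zero_le_one X).summable.hasSum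
  have h2 := (ContinuousLinearMapWOT.tendsto_iff_forall_inner_apply_tendsto.1 h1) x y
  simp only [inner_sum_wot, inner_phiTerm] at h2
  exact h2

theorem RowBound.smul (hT : RowBound f T 1) {r : ℝ} (hr : r ∈ Set.Icc (0 : ℝ) 1) :
    RowBound f (fun i => (r : ℂ) • T i) (r ^ 2) := by
  intro x s
  have h1 := mul_le_mul_of_nonneg_left (hT x s) (sq_nonneg r)
  rw [one_mul] at h1
  refine le_trans ?_ h1
  rw [Finset.mul_sum]
  refine Finset.sum_le_sum fun α _ => ?_
  rw [norm_adjoint_wordProd_smul hr.1]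
  -- The empty word gains no factor of r, but its coefficient vanishes; every other word gains
  -- r^{2|α|} ≤ r².
  by_cases hα : α = 1
  · simp [hα, f.coeff_one]
  have h2 : r ^ α.length ≤ r := pow_le_of_le_one hr.1 hr.2 (by simpa using hα)
  have h3 : (r ^ α.length) ^ 2 ≤ r ^ 2 := pow_le_pow_left₀ (pow_nonneg hr.1 _) h2 2
  have h4 := mul_le_mul_of_nonneg_right h3
    (mul_nonneg (f.coeff_nonneg α) (sq_nonneg ‖adjoint (wordProd T α) x‖))
  linarith

theorem smul_mem_domain (hT : T ∈ domain f H) {r : ℝ} (hr : r ∈ Set.Icc (0 : ℝ) 1) :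
    (fun i => (r : ℂ) • T i) ∈ domain f H :=
  ((rowBound_of_mem_domain hT).smul hr).mem_domain (sq_nonneg r) (pow_le_one₀ hr.1 hr.2)

theorem isPure_smul (hT : T ∈ domain f H) {r : ℝ} (hr : r ∈ Set.Ico (0 : ℝ) 1) :
    IsPure f (fun i => (r : ℂ) • T i) := by
  have hB := (rowBound_of_mem_domain hT).smul (Set.Ico_subset_Icc_self hr)
  intro h
  have h1 : ∀ m : ℕ, ‖(phi f fun i => (r : ℂ) • T i)^[m] 1‖ ≤ (r ^ 2) ^ m := by
    intro m
    induction m with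
    | zero =>
      rw [pow_zero]
      exact ContinuousLinearMap.norm_id_le
    | succ m ih =>
      rw [Function.iterate_succ_apply', pow_succ']
      exact (hB.norm_phi_le (sq_nonneg r) _).trans (mul_le_mul_of_nonneg_left ih (sq_nonneg r))
  have h2 : Tendsto (fun m : ℕ => (r ^ 2) ^ m * ‖h‖) atTop (𝓝 0) := by
    simpa using (tendsto_pow_atTop_nhds_zero_of_lt_one (sq_nonneg r)
      (pow_lt_one₀ hr.1 hr.2 two_ne_zero)).mul_const ‖h‖
  exact squeeze_zero_norm (fun m => ContinuousLinearMap.le_of_opNorm_le _ (h1 m) h) h2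

end RowBound

end

/-! ### The Poisson kernel: isometric for pure tuples, injective for completely non-coisometric
ones. -/

section

/-- Prepending `p.1` to a factorization of `p.2` gives a factorization of δ, and the new list
determines the pair and the old list. So the left side sums over a subset of the factorizations
defining b_δ. -/
theorem PositiveRegular.sum_coeff_mul_b_le {n : ℕ} (f : PositiveRegular n) (δ : Word n)
    (P : Finset (Word n × Word n)) (hP : ∀ p ∈ P, p.1 ≠ 1 ∧ p.1 * p.2 = δ) :
    ∑ p ∈ P, f.coeff p.1 * f.b p.2 ≤ f.b δ := by
  classical
  have h1 : ∀ p ∈ P, f.coeff p.1 * f.b p.2 =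
      ∑ l ∈ (factorizations_finite p.2).toFinset, ((p.1 :: l).map f.coeff).prod := by
    intro p _
    rw [PositiveRegular.b, Finset.mul_sum]
    simp
  rw [Finset.sum_congr rfl h1, Finset.sum_sigma']
  rw [← Finset.sum_image (f := fun l : List (Word n) => (l.map f.coeff).prod)
    (g := fun x : (_ : Word n × Word n) × List (Word n) => x.1.1 :: x.2)]
  · refine Finset.sum_le_sum_of_subset_of_nonneg ?_ fun l _ _ => f.term_nonneg l
    intro l hl
    obtain ⟨⟨p, l⟩, hx, rfl⟩ := Finset.mem_image.1 hl
    obtain ⟨hp, hl⟩ := Finset.mem_sigma.1 hx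
    obtain ⟨hl1, hl2⟩ := (Set.Finite.mem_toFinset _).1 hl
    obtain ⟨hp1, hp2⟩ := hP p hp
    refine (Set.Finite.mem_toFinset _).2 ⟨?_, fun γ hγ => ?_⟩
    · rw [List.prod_cons, hl1, hp2]
    · rcases List.mem_cons.1 hγ with rfl | hγ
      · exact Nat.one_le_iff_ne_zero.2 (by simpa using hp1)
      · exact hl2 γ hγ
  · rintro ⟨⟨p, q⟩, l⟩ hx ⟨⟨p', q'⟩, l'⟩ hx' h
    simp only [Finset.coe_sigma, Set.mem_sigma_iff, Finset.mem_coe, Set.Finite.mem_toFinset]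
      at hx hx'
    obtain ⟨-, ⟨rfl, -⟩⟩ := hx
    obtain ⟨-, ⟨rfl, -⟩⟩ := hx'
    simp only [List.cons.injEq] at h
    obtain ⟨rfl, rfl⟩ := h
    rfl

variable {n : ℕ} {H : Type*} [NormedAddCommGroup H] [InnerProductSpace ℂ H]

theorem inner_tensor (x y : Fock n) (h k : H) :
    inner ℂ (tensor x h) (tensor y k) = inner ℂ x y * inner ℂ h k := by
  rw [tensor, tensor, UniformSpace.Completion.inner_coe, TensorProduct.inner_tmul]

theorem inner_tensor_e (α γ : Word n) (h k : H) :
    inner ℂ (tensor (e α) h) (tensor (e γ) k) = if α = γ then inner ℂ h k else 0 := by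
  rw [inner_tensor, orthonormal_iff_ite.1 (e_orthonormal n)]
  simp

variable [CompleteSpace H] {f : PositiveRegular n} {T : Fin n → H →L[ℂ] H}

theorem norm_poissonKernel_apply_le (hT : T ∈ domain f H) (h : H) :
    ‖poissonKernel f T h‖ ≤ ‖h‖ := by
  rw [poissonKernel, dif_pos hT, ContinuousLinearMap.comp_apply,
    LinearIsometry.coe_toContinuousLinearMap, LinearIsometry.norm_map]
  simpa using (LinearMap.mkContinuous_norm_le _ zero_le_one _ :
    ‖kernelSeq f T hT‖ ≤ 1) |> fun h1 => (kernelSeq f T hT).le_of_opNorm_le h1 h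

theorem norm_poissonKernel_le (hT : T ∈ domain f H) : ‖poissonKernel f T‖ ≤ 1 :=
  ContinuousLinearMap.opNorm_le_bound _ zero_le_one fun h => by
    simpa using norm_poissonKernel_apply_le hT h

theorem hasSum_norm_poissonKernel_sq (hT : T ∈ domain f H) (h : H) :
    HasSum (fun α => f.b α * ‖defect f T (adjoint (wordProd T α) h)‖ ^ 2)
      (‖poissonKernel f T h‖ ^ 2) := by
  have h1 := lp.hasSum_norm (p := 2) (by norm_num) (kernelSeq f T hT h)
  rw [poissonKernel, dif_pos hT, ContinuousLinearMap.comp_apply,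
    LinearIsometry.coe_toContinuousLinearMap, LinearIsometry.norm_map]
  have h2 : ∀ α, ‖kernelSeq f T hT h α‖ ^ 2 =
      f.b α * ‖defect f T (adjoint (wordProd T α) h)‖ ^ 2 := by
    intro α
    change ‖kernelCoord f T h α‖ ^ 2 = _
    rw [kernelCoord, norm_smul, Complex.norm_real, Real.norm_eq_abs,
      abs_of_nonneg (Real.sqrt_nonneg _), mul_pow, Real.sq_sqrt (f.b_pos α).le]
  simpa [h2] using h1

theorem adjoint_defect (f : PositiveRegular n) (T : Fin n → H →L[ℂ] H) :
    adjoint (defect f T) = defect f T :=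
  (IsSelfAdjoint.of_nonneg (CFC.sqrt_nonneg (1 - phi f T 1))).adjoint_eq

/-- Pairing with e_γ ⊗ x isolates the γ-th term of the kernel. As these vectors span a dense
subspace, the formula determines K^*. -/
theorem adjoint_poissonKernel_tensor_e (hT : T ∈ domain f H) (γ : Word n) (x : H) :
    adjoint (poissonKernel f T) (tensor (e γ) x) =
      ((√(f.b γ) : ℝ) : ℂ) • wordProd T γ (defect f T x) := by
  refine ext_inner_left ℂ fun h => ?_
  rw [ContinuousLinearMap.adjoint_inner_right]
  have h1 := (hasSum_poissonKernel hT h).mapL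
    ((innerSL ℂ (tensor (e γ) x : FockTensor n H)))
  have h2 := h1.unique (hasSum_single γ fun α hα => ?_)
  · rw [← inner_conj_symm]
    rw [innerSL_apply_apply] at h2
    rw [h2, innerSL_apply_apply, inner_smul_right, inner_tensor_e, if_pos rfl, inner_smul_right,
      map_mul, Complex.conj_ofReal, inner_conj_symm, ← ContinuousLinearMap.adjoint_inner_left,
      ← ContinuousLinearMap.adjoint_inner_left (defect f T), adjoint_defect]
  · rw [innerSL_apply_apply, inner_smul_right, inner_tensor_e, if_neg hα.symm, mul_zero]

/-- The recursion behind isometry: with D(x) = ‖x‖² - ‖Kx‖², it says D(h) ≤ ∑ a_β D(T_β^* h).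
Expanding every ‖K T_β^* h‖² and collecting words δ = βγ, the combinatorial inequality ∑ a_β b_γ ≤
b_δ bounds the result by ‖Kh‖² without its empty-word term ‖Δh‖², and ‖Δh‖² = ‖h‖² - ⟨Φ(I)h, h⟩. -/
theorem norm_sq_sub_norm_poissonKernel_sq_le (hT : T ∈ domain f H) (h : H) {L : ℝ}
    (hL : HasSum (fun β => f.coeff β * (‖adjoint (wordProd T β) h‖ ^ 2 -
      ‖poissonKernel f T (adjoint (wordProd T β) h)‖ ^ 2)) L) :
    ‖h‖ ^ 2 - ‖poissonKernel f T h‖ ^ 2 ≤ L := by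
  classical
  have h1 := (hasSum_phi hT h).1
  have h2 : HasSum (fun β => f.coeff β * ‖poissonKernel f T (adjoint (wordProd T β) h)‖ ^ 2)
      ((inner ℂ h (phi f T 1 h)).re - L) := by
    refine (h1.sub hL).congr_fun fun β => ?_
    ring
  set q : Word n → ℝ := fun α => ‖defect f T (adjoint (wordProd T α) h)‖ ^ 2 with hq
  have hq0 : ∀ α, 0 ≤ q α := fun α => sq_nonneg _
  have h3 : (inner ℂ h (phi f T 1 h)).re - L ≤ ‖poissonKernel f T h‖ ^ 2 - q 1 := by
    refine hasSum_le_of_sum_le h2 fun s => ?_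
    have h4 : HasSum (fun γ => ∑ β ∈ s, f.coeff β * (f.b γ * q (β * γ)))
        (∑ β ∈ s, f.coeff β * ‖poissonKernel f T (adjoint (wordProd T β) h)‖ ^ 2) := by
      refine hasSum_sum fun β _ => ?_
      have := (hasSum_norm_poissonKernel_sq hT (adjoint (wordProd T β) h)).mul_left (f.coeff β)
      simpa only [hq, adjoint_wordProd_mul] using this
    refine hasSum_le_of_sum_le h4 fun t => ?_
    have h5 : ∑ γ ∈ t, ∑ β ∈ s, f.coeff β * (f.b γ * q (β * γ)) =
        ∑ p ∈ s.erase 1 ×ˢ t, f.coeff p.1 * f.b p.2 * q (p.1 * p.2) := by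
      rw [Finset.sum_comm, Finset.sum_product, Finset.sum_erase _ (by simp [f.coeff_one])]
      simp only [mul_assoc]
    let D := (s.erase 1 ×ˢ t).image fun p => p.1 * p.2
    -- Only β ≠ 1 contributes, so no product βγ is empty and the term `q 1` of ‖Kh‖² stays
    -- available.
    have hD : (1 : Word n) ∉ D := by
      intro h6
      obtain ⟨p, hp, hp1⟩ := Finset.mem_image.1 h6
      have h7 := (Finset.mem_product.1 hp).1
      have h8 : p.1.length = 0 := by
        have := congrArg FreeMonoid.length hp1
        simp only [FreeMonoid.length_mul, FreeMonoid.length_one] at this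
        omega
      exact Finset.ne_of_mem_erase h7 (by simpa using h8)
    have h6 : ∑ p ∈ s.erase 1 ×ˢ t, f.coeff p.1 * f.b p.2 * q (p.1 * p.2) ≤
        ∑ δ ∈ D, f.b δ * q δ := by
      rw [← Finset.sum_fiberwise_of_maps_to (g := fun p : Word n × Word n => p.1 * p.2) (t := D)
        fun p hp => Finset.mem_image_of_mem _ hp]
      refine Finset.sum_le_sum fun δ _ => ?_
      refine le_trans (le_of_eq ?_) (mul_le_mul_of_nonneg_right (f.sum_coeff_mul_b_le δ
        ((s.erase 1 ×ˢ t).filter fun p => p.1 * p.2 = δ) fun p hp => ?_) (hq0 δ))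
      · rw [Finset.sum_mul]
        exact Finset.sum_congr rfl fun p hp => by rw [(Finset.mem_filter.1 hp).2]
      · obtain ⟨hp1, hp2⟩ := Finset.mem_filter.1 hp
        exact ⟨Finset.ne_of_mem_erase (Finset.mem_product.1 hp1).1, hp2⟩
    have h7 := sum_le_hasSum (insert 1 D) (fun α _ => mul_nonneg (f.b_pos α).le (hq0 α))
      (hasSum_norm_poissonKernel_sq hT h)
    rw [Finset.sum_insert hD, f.b_one, one_mul] at h7
    rw [h5]
    have h8 : q 1 + ∑ δ ∈ D, f.b δ * q δ ≤ ‖poissonKernel f T h‖ ^ 2 := h7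
    linarith
  have h4 : q 1 = ‖h‖ ^ 2 - (inner ℂ h (phi f T 1 h)).re := by
    rw [← norm_defect_sq hT, hq]
    simp [wordProd_one, ← ContinuousLinearMap.star_eq_adjoint]
  linarith

theorem hasSum_re_inner_phi (hT : T ∈ domain f H) (X : H →L[ℂ] H) (x : H) :
    HasSum (fun α => f.coeff α *
      (inner ℂ (adjoint (wordProd T α) x) (X (adjoint (wordProd T α) x))).re)
      (inner ℂ x (phi f T X x)).re := by
  simpa using Complex.hasSum_re (hasSum_inner_phi hT X x x)

/-- Iterating the recursion: the isometry defect of K is dominated by the quadratic form of Φ^m(I)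
for every m, so it vanishes when T is pure. -/
theorem norm_sq_sub_norm_poissonKernel_sq_le_iterate (hT : T ∈ domain f H) (m : ℕ) (h : H) :
    ‖h‖ ^ 2 - ‖poissonKernel f T h‖ ^ 2 ≤ (inner ℂ h ((phi f T)^[m] 1 h)).re := by
  induction m generalizing h with
  | zero =>
    have : (inner ℂ h h).re = ‖h‖ ^ 2 := inner_self_eq_norm_sq (𝕜 := ℂ) h
    rw [Function.iterate_zero_apply, one_apply_eq_self, this]
    exact sub_le_self _ (sq_nonneg _)
  | succ m ih =>
    rw [Function.iterate_succ_apply']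
    have h1 := hasSum_re_inner_phi hT ((phi f T)^[m] 1) h
    have h0 : ∀ x : H, 0 ≤ ‖x‖ ^ 2 - ‖poissonKernel f T x‖ ^ 2 := fun x =>
      sub_nonneg.2 (pow_le_pow_left₀ (norm_nonneg _) (norm_poissonKernel_apply_le hT x) 2)
    have h2 := fun β : Word n => mul_le_mul_of_nonneg_left
      (ih (adjoint (wordProd T β) h)) (f.coeff_nonneg β)
    -- Summability of the defect series comes by comparison with the series for Φ^{m+1}(I);
    -- nonnegativity of the terms is contractivity of K.
    have h3 := Summable.of_nonneg_of_le
      (fun β => mul_nonneg (f.coeff_nonneg β) (h0 (adjoint (wordProd T β) h))) h2 h1.summable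
    exact (norm_sq_sub_norm_poissonKernel_sq_le hT h h3.hasSum).trans
      (hasSum_le h2 h3.hasSum h1)

theorem norm_poissonKernel_of_isPure (hT : T ∈ domain f H) (hp : IsPure f T) (h : H) :
    ‖poissonKernel f T h‖ = ‖h‖ := by
  refine le_antisymm (norm_poissonKernel_apply_le hT h) ?_
  have h1 : Tendsto (fun m : ℕ => (inner ℂ h ((phi f T)^[m] 1 h)).re) atTop (𝓝 0) := by
    have := (Complex.continuous_re.tendsto _).comp
      ((tendsto_const_nhds (x := h)).inner (𝕜 := ℂ) (hp h))
    simpa [Function.comp_def] using this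
  have h2 := ge_of_tendsto' h1 fun m => norm_sq_sub_norm_poissonKernel_sq_le_iterate hT m h
  exact le_of_sq_le_sq (by linarith) (norm_nonneg _)

theorem adjoint_comp_poissonKernel (hT : T ∈ domain f H) (hp : IsPure f T) :
    adjoint (poissonKernel f T) ∘L poissonKernel f T = 1 :=
  (ContinuousLinearMap.norm_map_iff_adjoint_comp_self _).1 (norm_poissonKernel_of_isPure hT hp)

/-- Δh = 0 means ∑ a_β ‖T_β^* h‖² = ‖h‖², and the hypothesis passes from h to each T_β^* h, so the
identity propagates through the iterates. Hence a vector in the kernel of K contradicts complete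
non-coisometry. -/
theorem inner_iterate_phi_eq (hT : T ∈ domain f H) (m : ℕ) {h : H}
    (hh : ∀ α, defect f T (adjoint (wordProd T α) h) = 0) :
    inner ℂ h ((phi f T)^[m] 1 h) = ((‖h‖ ^ 2 : ℝ) : ℂ) := by
  induction m generalizing h with
  | zero => simp [inner_self_eq_norm_sq_to_K]
  | succ m ih =>
    rw [Function.iterate_succ_apply']
    refine (hasSum_inner_phi hT ((phi f T)^[m] 1) h h).unique ?_
    have h1 := norm_defect_sq hT h
    have h0 := hh 1
    rw [wordProd_one] at h0
    have h0' : defect f T h = 0 := by simpa [← ContinuousLinearMap.star_eq_adjoint] using h0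
    rw [h0', norm_zero, zero_pow two_ne_zero] at h1
    have h2 := (hasSum_phi hT h).1
    rw [← sub_eq_zero.1 h1.symm] at h2
    have h3 := Complex.hasSum_ofReal.2 h2
    refine h3.congr_fun fun α => ?_
    rw [ih fun β => by rw [← adjoint_wordProd_mul]; exact hh _]
    push_cast
    rfl

theorem poissonKernel_injective (hT : T ∈ domain f H) (hc : IsCNC f T) {h : H}
    (hh : poissonKernel f T h = 0) : h = 0 := by
  by_contra h0
  have h1 : ∀ α, defect f T (adjoint (wordProd T α) h) = 0 := by
    have h2 := hasSum_norm_poissonKernel_sq hT h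
    rw [hh, norm_zero, zero_pow two_ne_zero, hasSum_zero_iff_of_nonneg
      fun α => mul_nonneg (f.b_pos α).le (sq_nonneg _)] at h2
    intro α
    have := congrFun h2 α
    simpa [(f.b_pos α).ne'] using this
  refine hc ⟨h, h0, fun m _ => ?_⟩
  rw [← inner_conj_symm, inner_iterate_phi_eq hT m h1, Complex.conj_ofReal]

/-- The orthogonal complement of the range of K^* is the kernel of K. This is where complete
non-coisometry enters the calculus. -/
theorem denseRange_adjoint_poissonKernel (hT : T ∈ domain f H) (hc : IsCNC f T) :
    DenseRange (adjoint (poissonKernel f T)) := by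
  have h1 : (adjoint (poissonKernel f T)).rangeᗮ = ⊥ := by
    rw [ContinuousLinearMap.orthogonal_range, ContinuousLinearMap.adjoint_adjoint]
    exact (Submodule.eq_bot_iff _).2 fun h hh => poissonKernel_injective hT hc hh
  have h2 := Submodule.topologicalClosure_eq_top_iff.2 h1
  have h3 := Submodule.dense_iff_topologicalClosure_eq_top.2 h2
  exact h3

end

/-! ### Ampliations and slice maps on F² ⊗ H. -/

section

variable {n : ℕ} {H : Type*} [NormedAddCommGroup H] [InnerProductSpace ℂ H]

theorem norm_tensor (v : Fock n) (x : H) : ‖tensor v x‖ = ‖v‖ * ‖x‖ := by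
  simp [tensor]

/-- The operator `v ↦ v ⊗ x`. -/
noncomputable def tensorRight (n : ℕ) (x : H) : Fock n →L[ℂ] FockTensor n H :=
  LinearMap.mkContinuous
    { toFun := fun v => tensor v x
      map_add' := fun v w => (congrArg _ (TensorProduct.add_tmul v w x)).trans
        (UniformSpace.Completion.coe_add _ _)
      map_smul' := fun r v => by
        simp [tensor, ← TensorProduct.smul_tmul', UniformSpace.Completion.coe_smul] }
    ‖x‖ fun v => ((norm_tensor v x).trans (mul_comm _ _)).le

/-- The operator `x ↦ v ⊗ x`. -/
noncomputable def tensorLeft (H : Type*) [NormedAddCommGroup H] [InnerProductSpace ℂ H]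
    (v : Fock n) : H →L[ℂ] FockTensor n H :=
  LinearMap.mkContinuous
    { toFun := fun x => tensor v x
      map_add' := fun x y => (congrArg _ (TensorProduct.tmul_add v x y)).trans
        (UniformSpace.Completion.coe_add _ _)
      map_smul' := fun r x => by
        simp [tensor, UniformSpace.Completion.coe_smul] }
    ‖v‖ fun x => (norm_tensor v x).le

@[simp] theorem tensorRight_apply (v : Fock n) (x : H) : tensorRight n x v = tensor v x := rfl

theorem dense_span_e (n : ℕ) : Dense (Submodule.span ℂ (Set.range (e : Word n → Fock n)) :
    Set (Fock n)) := by
  intro v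
  refine mem_closure_of_tendsto (lp.hasSum_single (p := 2) (by norm_num) v)
    (Eventually.of_forall fun s => ?_)
  refine Submodule.sum_mem _ fun α _ => ?_
  have : lp.single 2 α (v α) = v α • e α := by
    rw [e, ← lp.single_smul, smul_eq_mul, mul_one]
  rw [this]
  exact Submodule.smul_mem _ _ (Submodule.subset_span ⟨α, rfl⟩)

theorem dense_of_tensor_mem {N : Submodule ℂ (FockTensor n H)} (hN : ∀ v x, tensor v x ∈ N) :
    Dense (N : Set (FockTensor n H)) := by
  refine UniformSpace.Completion.denseRange_coe.mono ?_
  rintro _ ⟨z, rfl⟩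
  induction z using TensorProduct.induction_on with
  | zero =>
    rw [UniformSpace.Completion.coe_zero]
    exact N.zero_mem
  | tmul v x => exact hN v x
  | add x y hx hy =>
    rw [UniformSpace.Completion.coe_add]
    exact N.add_mem hx hy

theorem mem_closure_of_dense_span {E F : Type*} [NormedAddCommGroup E] [NormedSpace ℂ E]
    [NormedAddCommGroup F] [NormedSpace ℂ F] (A : E →L[ℂ] F) {s : Set E}
    (hs : Dense (Submodule.span ℂ s : Set E)) {N : Submodule ℂ F} (hN : ∀ x ∈ s, A x ∈ N) (x : E) :
    A x ∈ N.topologicalClosure := by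
  have h1 : Submodule.span ℂ s ≤ N.comap A.toLinearMap := Submodule.span_le.2 hN
  exact map_mem_closure A.continuous (hs x) fun y hy => h1 hy

theorem dense_span_tensor_e (n : ℕ) (H : Type*) [NormedAddCommGroup H] [InnerProductSpace ℂ H] :
    Dense (Submodule.span ℂ (Set.range fun p : Word n × H => (tensor (e p.1) p.2)) :
      Set (FockTensor n H)) := by
  rw [← dense_closure]
  refine dense_of_tensor_mem (N := (Submodule.span ℂ _).topologicalClosure) fun v x => ?_
  refine mem_closure_of_dense_span (tensorRight n x) (dense_span_e n) ?_ v
  rintro _ ⟨γ, rfl⟩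
  exact Submodule.subset_span ⟨(γ, x), rfl⟩

theorem ext_tensor_e {F : Type*} [NormedAddCommGroup F] [NormedSpace ℂ F]
    {A B : FockTensor n H →L[ℂ] F} (h : ∀ γ x, A (tensor (e γ) x) = B (tensor (e γ) x)) :
    A = B :=
  ContinuousLinearMap.ext_on (dense_span_tensor_e n H) (by rintro _ ⟨p, rfl⟩; exact h _ _)

theorem norm_ampliation_le (g : Fock n →L[ℂ] Fock n) : ‖ampliation H g‖ ≤ ‖g‖ := by
  refine ContinuousLinearMap.opNorm_le_bound _ (norm_nonneg _) fun z => ?_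
  induction z using UniformSpace.Completion.induction_on with
  | hp => exact isClosed_le (by fun_prop) (by fun_prop)
  | ih z =>
    rw [ampliation, ContinuousLinearMap.completion_apply_coe, UniformSpace.Completion.norm_coe,
      UniformSpace.Completion.norm_coe]
    exact ContinuousLinearMap.le_of_opNorm_le _ (ContinuousLinearMap.norm_rTensor_le H g) z

theorem ampliation_one : ampliation H (1 : Fock n →L[ℂ] Fock n) = 1 :=
  ext_tensor_e fun γ x => by simp [ampliation_tensor]

theorem ampliation_mul (g h : Fock n →L[ℂ] Fock n) :
    ampliation H (g * h) = ampliation H g ∘L ampliation H h :=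
  ext_tensor_e fun γ x => by simp [ampliation_tensor]

theorem ampliation_add (g h : Fock n →L[ℂ] Fock n) :
    ampliation H (g + h) = ampliation H g + ampliation H h :=
  ext_tensor_e fun γ x => by
    simp only [ampliation_tensor, add_apply]
    exact (tensorRight n x).map_add _ _

theorem ampliation_smul (r : ℂ) (g : Fock n →L[ℂ] Fock n) :
    ampliation H (r • g) = r • ampliation H g :=
  ext_tensor_e fun γ x => by
    simp only [ampliation_tensor, smul_apply]
    exact (tensorRight n x).map_smul _ _

/-- The slice map `v ⊗ x ↦ ⟨u, x⟩ v`. -/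
noncomputable def slice (n : ℕ) (u : H) : FockTensor n H →L[ℂ] Fock n := adjoint (tensorRight n u)

theorem slice_tensor (u x : H) (v : Fock n) : slice n u (tensor v x) = inner ℂ u x • v := by
  refine ext_inner_left ℂ fun w => ?_
  rw [slice, ContinuousLinearMap.adjoint_inner_right, tensorRight_apply, tensor, tensor,
    UniformSpace.Completion.inner_coe, TensorProduct.inner_tmul, inner_smul_right, mul_comm]

/-- Slices intertwine g ⊗ I with g, so a statement about g ⊗ I reduces to one about g on each slice.
-/
theorem slice_ampliation (u : H) (g : Fock n →L[ℂ] Fock n) (ξ : FockTensor n H) :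
    slice n u (ampliation H g ξ) = g (slice n u ξ) := by
  have : slice n u ∘L ampliation H g = g ∘L slice n u :=
    ext_tensor_e fun γ x => by simp [ampliation_tensor, slice_tensor]
  exact DFunLike.congr_fun this ξ

/-! ### Parseval's identity for slices along a Hilbert basis of H. -/

section Parseval

variable {ι : Type*} (b : HilbertBasis ι ℂ H)

/-- The isometry `v ↦ v ⊗ b_i`, for a Hilbert basis `b` of `H`. -/
noncomputable def tensorBasis (n : ℕ) (i : ι) : Fock n →ₗᵢ[ℂ] FockTensor n H where
  toLinearMap := (tensorRight n (b i)).toLinearMap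
  norm_map' v := by
    change ‖tensor v (b i)‖ = ‖v‖
    rw [norm_tensor, b.orthonormal.1 i, mul_one]

theorem isHilbertSum_tensorBasis [CompleteSpace H] :
    IsHilbertSum ℂ (fun _ : ι => Fock n) (tensorBasis b n) := by
  refine IsHilbertSum.mk (fun i j hij v w => ?_) ?_
  · change inner ℂ (tensor v (b i)) (tensor w (b j)) = 0
    rw [inner_tensor, b.orthonormal.2 hij, mul_zero]
  · rw [top_le_iff, ← Submodule.dense_iff_topologicalClosure_eq_top, ← dense_closure]
    refine dense_of_tensor_mem (N := Submodule.topologicalClosure _) fun v x => ?_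
    refine mem_closure_of_dense_span (tensorLeft H v)
      (Submodule.dense_iff_topologicalClosure_eq_top.2 b.dense_span) ?_ x
    rintro _ ⟨i, rfl⟩
    exact Submodule.mem_iSup_of_mem i ⟨v, rfl⟩

theorem linearIsometryEquiv_tensorBasis_apply [CompleteSpace H] (ξ : FockTensor n H) (i : ι) :
    (isHilbertSum_tensorBasis b).linearIsometryEquiv ξ i = slice n (b i) ξ := by
  classical
  refine ext_inner_left ℂ fun w => ?_
  refine (lp.inner_single_left (𝕜 := ℂ) i w
    ((isHilbertSum_tensorBasis b).linearIsometryEquiv ξ)).symm.trans ?_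
  rw [slice, ContinuousLinearMap.adjoint_inner_right,
    ← LinearIsometryEquiv.inner_map_map ((isHilbertSum_tensorBasis b).linearIsometryEquiv).symm,
    LinearIsometryEquiv.symm_apply_apply, IsHilbertSum.linearIsometryEquiv_symm_apply_single]
  rfl

theorem hasSum_inner_slice [CompleteSpace H] (η ξ : FockTensor n H) :
    HasSum (fun i => inner ℂ (slice n (b i) η) (slice n (b i) ξ)) (inner ℂ η ξ) := by
  have h1 := lp.hasSum_inner (𝕜 := ℂ) ((isHilbertSum_tensorBasis b).linearIsometryEquiv η)
    ((isHilbertSum_tensorBasis b).linearIsometryEquiv ξ)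
  rw [LinearIsometryEquiv.inner_map_map] at h1
  simpa only [linearIsometryEquiv_tensorBasis_apply] using h1

theorem hasSum_norm_slice_sq [CompleteSpace H] (ξ : FockTensor n H) :
    HasSum (fun i => ‖slice n (b i) ξ‖ ^ 2) (‖ξ‖ ^ 2) := by
  have h1 := Complex.hasSum_re (hasSum_inner_slice b ξ ξ)
  have h2 : (inner ℂ ξ ξ).re = ‖ξ‖ ^ 2 := inner_self_eq_norm_sq (𝕜 := ℂ) ξ
  have h3 : ∀ i, (inner ℂ (slice n (b i) ξ) (slice n (b i) ξ)).re = ‖slice n (b i) ξ‖ ^ 2 :=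
    fun i => inner_self_eq_norm_sq (𝕜 := ℂ) _
  simpa only [h2, h3] using h1

end Parseval

/-! ### Norms of operator matrices. -/

section Block

variable {E : Type*} [NormedAddCommGroup E] [InnerProductSpace ℂ E] {m : ℕ}

theorem blockOp_apply (A : Matrix (Fin m) (Fin m) (E →L[ℂ] E)) (x : PiLp 2 fun _ : Fin m => E)
    (i : Fin m) : blockOp A x i = ∑ j, A i j (x j) := by
  simp [blockOp]

theorem norm_blockOp_apply_sq (A : Matrix (Fin m) (Fin m) (E →L[ℂ] E))
    (x : PiLp 2 fun _ : Fin m => E) : ‖blockOp A x‖ ^ 2 = ∑ i, ‖∑ j, A i j (x j)‖ ^ 2 := by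
  rw [PiLp.norm_sq_eq_of_L2]
  simp only [blockOp_apply]

theorem sum_norm_sq_le_blockOp (A : Matrix (Fin m) (Fin m) (E →L[ℂ] E)) (x : Fin m → E) :
    ∑ i, ‖∑ j, A i j (x j)‖ ^ 2 ≤ ‖blockOp A‖ ^ 2 * ∑ j, ‖x j‖ ^ 2 := by
  have h1 := norm_blockOp_apply_sq A (WithLp.toLp 2 x)
  have h2 := PiLp.norm_sq_eq_of_L2 (fun _ : Fin m => E) (WithLp.toLp 2 x)
  simp only at h1 h2
  rw [← h1, ← h2, ← mul_pow]
  exact pow_le_pow_left₀ (norm_nonneg _) ((blockOp A).le_opNorm _) 2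

theorem norm_blockOp_le {A : Matrix (Fin m) (Fin m) (E →L[ℂ] E)} {C : ℝ} (hC : 0 ≤ C)
    (h : ∀ x : Fin m → E, ∑ i, ‖∑ j, A i j (x j)‖ ^ 2 ≤ C ^ 2 * ∑ j, ‖x j‖ ^ 2) :
    ‖blockOp A‖ ≤ C := by
  refine ContinuousLinearMap.opNorm_le_bound _ hC fun x => ?_
  refine le_of_sq_le_sq ?_ (by positivity)
  rw [norm_blockOp_apply_sq, mul_pow, PiLp.norm_sq_eq_of_L2]
  exact h x

/-- By Parseval, both sides split into sums over a Hilbert basis of H, and on each slice the matrix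
acts as A itself. -/
theorem norm_blockOp_ampliation_le [CompleteSpace H]
    (A : Matrix (Fin m) (Fin m) (Fock n →L[ℂ] Fock n)) :
    ‖blockOp (A.map (ampliation H))‖ ≤ ‖blockOp A‖ := by
  obtain ⟨w, b, -⟩ := exists_hilbertBasis ℂ H
  refine norm_blockOp_le (norm_nonneg _) fun ξ => ?_
  have h1 : HasSum (fun u => ∑ i, ‖slice n (b u) (∑ j, ampliation H (A i j) (ξ j))‖ ^ 2)
      (∑ i, ‖∑ j, ampliation H (A i j) (ξ j)‖ ^ 2) :=
    hasSum_sum fun i _ => hasSum_norm_slice_sq b _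
  have h2 : HasSum (fun u => ‖blockOp A‖ ^ 2 * ∑ j, ‖slice n (b u) (ξ j)‖ ^ 2)
      (‖blockOp A‖ ^ 2 * ∑ j, ‖ξ j‖ ^ 2) :=
    (hasSum_sum fun j _ => hasSum_norm_slice_sq b (ξ j)).mul_left _
  refine hasSum_le (fun u => ?_) h1 h2
  simp only [map_sum, slice_ampliation]
  exact sum_norm_sq_le_blockOp A _

theorem norm_blockOp_conj_le {F : Type*} [NormedAddCommGroup F] [InnerProductSpace ℂ F]
    [CompleteSpace E] [CompleteSpace F] {K : E →L[ℂ] F} (hK : ‖K‖ ≤ 1)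
    (A : Matrix (Fin m) (Fin m) (F →L[ℂ] F)) :
    ‖blockOp (A.map fun X => adjoint K ∘L X ∘L K)‖ ≤ ‖blockOp A‖ := by
  refine norm_blockOp_le (norm_nonneg _) fun x => ?_
  have hK' : ‖adjoint K‖ ≤ 1 := by rwa [LinearIsometryEquiv.norm_map]
  calc ∑ i, ‖∑ j, (adjoint K ∘L A i j ∘L K) (x j)‖ ^ 2
      = ∑ i, ‖adjoint K (∑ j, A i j (K (x j)))‖ ^ 2 := by simp
    _ ≤ ∑ i, ‖∑ j, A i j (K (x j))‖ ^ 2 := by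
        gcongr with i
        simpa using (adjoint K).le_of_opNorm_le hK' (∑ j, A i j (K (x j)))
    _ ≤ ‖blockOp A‖ ^ 2 * ∑ j, ‖K (x j)‖ ^ 2 := sum_norm_sq_le_blockOp A _
    _ ≤ ‖blockOp A‖ ^ 2 * ∑ j, ‖x j‖ ^ 2 := by
        gcongr with j
        simpa using K.le_of_opNorm_le hK (x j)

theorem norm_blockOp_le_of_tendsto {ι : Type*} {l : Filter ι} [l.NeBot]
    {A : ι → Matrix (Fin m) (Fin m) (E →L[ℂ] E)} {B : Matrix (Fin m) (Fin m) (E →L[ℂ] E)} {C : ℝ}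
    (hC : 0 ≤ C) (hA : ∀ᶠ r in l, ‖blockOp (A r)‖ ≤ C)
    (h : ∀ i j x, Tendsto (fun r => A r i j x) l (𝓝 (B i j x))) : ‖blockOp B‖ ≤ C := by
  refine norm_blockOp_le hC fun x => ?_
  have h1 : Tendsto (fun r => ∑ i, ‖∑ j, A r i j (x j)‖ ^ 2) l
      (𝓝 (∑ i, ‖∑ j, B i j (x j)‖ ^ 2)) :=
    tendsto_finsetSum _ fun i _ => ((tendsto_finsetSum _ fun j _ => h i j (x j)).norm).pow 2
  refine le_of_tendsto h1 (hA.mono fun r hr => (sum_norm_sq_le_blockOp (A r) x).trans ?_)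
  gcongr

end Block

end

/-! ### The operators g_r(T): norm convergence and intertwining with the kernel. -/

section

variable {n : ℕ} {H : Type*} [NormedAddCommGroup H] [InnerProductSpace ℂ H] [CompleteSpace H]
  {f : PositiveRegular n} {T : Fin n → H →L[ℂ] H} {c : Word n → ℂ} {g : Fock n →L[ℂ] Fock n}

/-- The weights telescope: √(b_γ/b_{αγ}) · √b_{αγ} = √b_γ, so K^* carries W_α e_γ ⊗ x to T_α K^*(e_γ
⊗ x). -/
theorem HasFourier.hasSum_adjoint_poissonKernel (hg : HasFourier f c g) (hT : T ∈ domain f H)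
    (γ : Word n) (x : H) :
    HasSum (fun α => c α • wordProd T α (adjoint (poissonKernel f T) (tensor (e γ) x)))
      (adjoint (poissonKernel f T) (tensor (g (e γ)) x)) := by
  have h1 := (hg.2 (e γ) (Submodule.subset_span ⟨γ, rfl⟩)).mapL
    (adjoint (poissonKernel f T) ∘L tensorRight n x)
  refine h1.congr_fun fun α => ?_
  rw [wordProd_W_e, map_smul, map_smul, ContinuousLinearMap.comp_apply, tensorRight_apply,
    adjoint_poissonKernel_tensor_e hT, adjoint_poissonKernel_tensor_e hT, map_smul, wordProd_mul,
    smul_smul (((√(f.b γ / f.b (α * γ)) : ℝ) : ℂ)), ← Complex.ofReal_mul,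
    ← Real.sqrt_mul (div_pos (f.b_pos _) (f.b_pos _)).le,
    div_mul_cancel₀ _ (f.b_pos _).ne', mul_apply_eq_comp]

/-- Each unit of length costs at most one ‖h‖². Splitting the last factor off every nonempty word,
b_δ ≤ ∑_{γβ=δ} b_γ a_β, and applying the row bound at T_γ^* h bounds the sum over 1 ≤ |δ| ≤ N + 1 by
the sum over |γ| ≤ N. -/
theorem sum_b_mul_norm_sq_le (hT : T ∈ domain f H) (h : H) (N : ℕ) :
    ∑ α ∈ (finite_length_le n N).toFinset, f.b α * ‖adjoint (wordProd T α) h‖ ^ 2 ≤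
      (N + 1) * ‖h‖ ^ 2 := by
  classical
  set p : Word n → ℝ := fun α => ‖adjoint (wordProd T α) h‖ ^ 2 with hp
  have hp0 : ∀ α, 0 ≤ p α := fun α => sq_nonneg _
  have hp1 : p 1 = ‖h‖ ^ 2 := by simp [hp, wordProd_one, ← ContinuousLinearMap.star_eq_adjoint]
  let F : ℕ → Finset (Word n) := fun N => (finite_length_le n N).toFinset
  have hF : ∀ (N : ℕ) (α : Word n), α ∈ F N ↔ α.length ≤ N := fun N α => by simp [F]
  change ∑ α ∈ F N, f.b α * p α ≤ (N + 1) * ‖h‖ ^ 2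
  induction N with
  | zero =>
    have : F 0 = {1} := by
      ext α
      simp [hF]
    rw [this, Finset.sum_singleton, f.b_one, hp1]
    simp
  | succ N ih =>
    let t : Word n × Word n → ℝ := fun x => f.b x.1 * f.coeff x.2 * p (x.1 * x.2)
    have h1 : ∑ δ ∈ (F (N + 1)).erase 1, f.b δ * p δ ≤ ∑ x ∈ F N ×ˢ F (N + 1), t x := by
      calc ∑ δ ∈ (F (N + 1)).erase 1, f.b δ * p δ
          ≤ ∑ δ ∈ (F (N + 1)).erase 1,
              ∑ x ∈ (F N ×ˢ F (N + 1)).filter (fun x => x.1 * x.2 = δ), t x := by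
            refine Finset.sum_le_sum fun δ hδ => ?_
            obtain ⟨hδ1, hδF⟩ := Finset.mem_erase.1 hδ
            have h2 := f.b_le_sum hδ1 (F (N + 1)) fun γ hγ =>
              (hF _ γ).2 (hγ.trans ((hF _ δ).1 hδF))
            refine (mul_le_mul_of_nonneg_right h2 (hp0 δ)).trans (le_of_eq ?_)
            rw [Finset.sum_mul]
            -- Restricting the first factor to length at most N loses nothing: length N + 1 forces
            -- the second factor to be empty, and its coefficient is zero.
            refine (Finset.sum_subset_zero_on_sdiff (fun x hx => ?_) (fun x hx => ?_)
              fun x hx => ?_).symm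
            · simp only [Finset.mem_filter, Finset.mem_product, hF] at hx ⊢
              exact ⟨⟨by omega, hx.1.2⟩, hx.2⟩
            · simp only [Finset.mem_sdiff, Finset.mem_filter, Finset.mem_product, hF] at hx
              obtain ⟨⟨⟨h3, h4⟩, h5⟩, h6⟩ := hx
              have h7 : x.1.length + x.2.length ≤ N + 1 := by
                rw [← FreeMonoid.length_mul, h5]
                exact (hF _ δ).1 hδF
              have h8 : x.2.length = 0 := by
                by_contra h9
                exact h6 ⟨⟨by omega, h4⟩, h5⟩
              rw [FreeMonoid.length_eq_zero.1 h8, f.coeff_one, mul_zero, zero_mul]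
            · simp only [t, (Finset.mem_filter.1 hx).2]
        _ ≤ _ := Finset.sum_fiberwise_le_sum_of_sum_fiber_nonneg fun y _ =>
            Finset.sum_nonneg fun x _ =>
              mul_nonneg (mul_nonneg (f.b_pos _).le (f.coeff_nonneg _)) (hp0 _)
    have h2 : ∑ x ∈ F N ×ˢ F (N + 1), t x ≤ ∑ γ ∈ F N, f.b γ * p γ := by
      rw [Finset.sum_product]
      refine Finset.sum_le_sum fun γ _ => ?_
      have h3 := mul_le_mul_of_nonneg_left (rowBound_of_mem_domain hT
        (adjoint (wordProd T γ) h) (F (N + 1))) (f.b_pos γ).le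
      rw [one_mul, Finset.mul_sum] at h3
      refine (Finset.sum_congr rfl fun β _ => ?_).trans_le h3
      simp only [t, hp, adjoint_wordProd_mul]
      ring
    have h3 : (1 : Word n) ∈ F (N + 1) := by simp [hF]
    rw [← Finset.add_sum_erase _ _ h3, f.b_one, one_mul, hp1]
    push_cast
    linarith

theorem sum_wordOf_le {φ : Word n → ℝ} (hφ : ∀ α, 0 ≤ φ α) (k : ℕ) :
    ∑ α : Fin k → Fin n, φ (wordOf α) ≤ ∑ α ∈ (finite_length_le n k).toFinset, φ α := by
  classical
  have hinj : Function.Injective (wordOf : (Fin k → Fin n) → Word n) := fun α β h =>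
    List.ofFn_injective h
  rw [← Finset.sum_image (f := φ) (g := wordOf) hinj.injOn]
  refine Finset.sum_le_sum_of_subset_of_nonneg (fun δ hδ => ?_) fun α _ _ => hφ α
  obtain ⟨α, -, rfl⟩ := Finset.mem_image.1 hδ
  simp [wordOf, FreeMonoid.length]

theorem length_wordOf {k : ℕ} (α : Fin k → Fin n) : (wordOf α).length = k :=
  List.length_ofFn

/-- Pair the output y with itself and apply Cauchy–Schwarz with weights 1/b_α on the coefficients
and b_α on ‖T_α^* y‖². The growth √(k + 1) is beaten by r^k, which gives norm convergence. -/
theorem norm_sum_smul_wordProd_le (hT : T ∈ domain f H)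
    (hc : Summable fun β => ‖c β‖ ^ 2 * (1 / f.b β)) (k : ℕ) :
    ‖∑ α : Fin k → Fin n, c (wordOf α) • wordProd T (wordOf α)‖ ≤
      √(∑' β, ‖c β‖ ^ 2 * (1 / f.b β)) * √(k + 1) := by
  set M := ∑' β, ‖c β‖ ^ 2 * (1 / f.b β)
  have hc0 : ∀ β, 0 ≤ ‖c β‖ ^ 2 * (1 / f.b β) := fun β =>
    mul_nonneg (sq_nonneg _) (one_div_nonneg.2 (f.b_pos β).le)
  refine ContinuousLinearMap.opNorm_le_bound _ (by positivity) fun x => ?_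
  set y := (∑ α : Fin k → Fin n, c (wordOf α) • wordProd T (wordOf α)) x with hy
  rcases eq_or_ne y 0 with h0 | h0
  · rw [h0, norm_zero]
    positivity
  refine le_of_mul_le_mul_right ?_ (norm_pos_iff.2 h0)
  have h1 : inner ℂ y y = ∑ α : Fin k → Fin n,
      c (wordOf α) * inner ℂ (adjoint (wordProd T (wordOf α)) y) x := by
    nth_rw 2 [hy]
    rw [sum_apply, inner_sum]
    refine Finset.sum_congr rfl fun α _ => ?_
    rw [smul_apply, inner_smul_right, ContinuousLinearMap.adjoint_inner_left]
  calc ‖y‖ * ‖y‖ = ‖inner ℂ y y‖ := by rw [inner_self_eq_norm_sq_to_K]; simp [sq]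
    _ ≤ ∑ α : Fin k → Fin n, (‖c (wordOf α)‖ * √(1 / f.b (wordOf α))) *
          (√(f.b (wordOf α)) * ‖adjoint (wordProd T (wordOf α)) y‖) * ‖x‖ := by
        rw [h1]
        refine (norm_sum_le _ _).trans (Finset.sum_le_sum fun α _ => ?_)
        have h2 : √(1 / f.b (wordOf α)) * √(f.b (wordOf α)) = 1 := by
          rw [← Real.sqrt_mul (one_div_nonneg.2 (f.b_pos _).le),
            one_div_mul_cancel (f.b_pos _).ne', Real.sqrt_one]
        rw [norm_mul]
        calc _ ≤ ‖c (wordOf α)‖ * (‖adjoint (wordProd T (wordOf α)) y‖ * ‖x‖) := by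
              gcongr; exact norm_inner_le_norm _ _
          _ = _ := by linear_combination -‖c (wordOf α)‖ *
                ‖adjoint (wordProd T (wordOf α)) y‖ * ‖x‖ * h2
    _ ≤ √M * (√(k + 1) * ‖y‖) * ‖x‖ := by
        rw [← Finset.sum_mul]
        gcongr
        refine (Real.sum_mul_le_sqrt_mul_sqrt _ _ _).trans ?_
        gcongr
        · simp only [mul_pow, Real.sq_sqrt (one_div_nonneg.2 (f.b_pos _).le)]
          exact (sum_wordOf_le hc0 k).trans (hc.sum_le_tsum _ fun β _ => hc0 β)
        · rw [Real.sqrt_le_left (by positivity), mul_pow, Real.sq_sqrt (by positivity)]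
          simp only [mul_pow, Real.sq_sqrt (f.b_pos _).le]
          exact (sum_wordOf_le (fun β => mul_nonneg (f.b_pos β).le (sq_nonneg _)) k).trans
            (sum_b_mul_norm_sq_le hT y k)
    _ = √M * √(k + 1) * ‖x‖ * ‖y‖ := by ring

theorem summable_dilation (hT : T ∈ domain f H)
    (hc : Summable fun β => ‖c β‖ ^ 2 * (1 / f.b β)) {r : ℝ} (hr : r ∈ Set.Ico (0 : ℝ) 1) :
    Summable fun k : ℕ => ∑ α : Fin k → Fin n,
      (c (wordOf α) * (r : ℂ) ^ k) • wordProd T (wordOf α) := by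
  set M := ∑' β, ‖c β‖ ^ 2 * (1 / f.b β)
  have h1 : Summable fun k : ℕ => √M * ((k + 1 : ℝ) * r ^ k) := by
    have hr' : ‖r‖ < 1 := by rw [Real.norm_eq_abs, abs_of_nonneg hr.1]; exact hr.2
    refine Summable.mul_left _ ?_
    simpa [add_mul] using (summable_pow_mul_geometric_of_norm_lt_one 1 hr').add
      (summable_geometric_of_norm_lt_one hr')
  refine Summable.of_norm_bounded h1 fun k => ?_
  have h2 : ∑ α : Fin k → Fin n, (c (wordOf α) * (r : ℂ) ^ k) • wordProd T (wordOf α) =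
      (r : ℂ) ^ k • ∑ α : Fin k → Fin n, c (wordOf α) • wordProd T (wordOf α) := by
    rw [Finset.smul_sum]
    exact Finset.sum_congr rfl fun α _ => by rw [smul_smul, mul_comm]
  rw [h2, norm_smul, norm_pow, Complex.norm_real, Real.norm_eq_abs, abs_of_nonneg hr.1]
  have h3 : √((k : ℝ) + 1) ≤ k + 1 := Real.sqrt_le_iff.2 ⟨by positivity, by
    nlinarith [(Nat.cast_nonneg k : (0 : ℝ) ≤ k)]⟩
  calc r ^ k * _ ≤ r ^ k * (√M * (k + 1)) := by
        have := hr.1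
        gcongr
        exact (norm_sum_smul_wordProd_le hT hc k).trans (by gcongr)
    _ = _ := by ring

/-- Regrouping by length: an unordered sum over all words, available at a particular vector, must
agree there with the norm-convergent series of homogeneous parts. -/
theorem dilation_apply_eq_of_hasSum (hT : T ∈ domain f H)
    (hc : Summable fun β => ‖c β‖ ^ 2 * (1 / f.b β)) {r : ℝ} (hr : r ∈ Set.Ico (0 : ℝ) 1) {y z : H}
    (h : HasSum (fun α => (c α * (r : ℂ) ^ α.length) • wordProd T α y) z) :
    dilation c r T y = z := by
  have h1 := (summable_dilation hT hc hr).hasSum.mapL (ContinuousLinearMap.apply ℂ H y)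
  refine h1.unique ?_
  have h2 := ((List.equivSigmaTuple (α := Fin n)).symm.hasSum_iff).2 h
  refine (h2.sigma fun k => hasSum_fintype _).congr_fun fun k => ?_
  simp only [ContinuousLinearMap.apply_apply, sum_apply, smul_apply]
  refine Finset.sum_congr rfl fun α _ => ?_
  change _ = (c (wordOf α) * (r : ℂ) ^ (wordOf α).length) • wordProd T (wordOf α) y
  rw [length_wordOf]

theorem HasFourier.dilation_comp_adjoint (hg : HasFourier f c g) (hT : T ∈ domain f H) {r : ℝ}
    (hr : r ∈ Set.Ico (0 : ℝ) 1) :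
    dilation c r T ∘L adjoint (poissonKernel f fun i => (r : ℂ) • T i) =
      adjoint (poissonKernel f fun i => (r : ℂ) • T i) ∘L ampliation H g := by
  refine ext_tensor_e fun γ x => ?_
  rw [ContinuousLinearMap.comp_apply, ContinuousLinearMap.comp_apply, ampliation_tensor]
  refine dilation_apply_eq_of_hasSum hT hg.1 hr ?_
  have h1 := hg.hasSum_adjoint_poissonKernel (smul_mem_domain hT (Set.Ico_subset_Icc_self hr)) γ x
  refine h1.congr_fun fun α => ?_
  rw [wordProd_smul, smul_apply, smul_smul]

/-- rT is pure, so K_{rT}^* K_{rT} = I; composing the intertwining relation with K_{rT} on the right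
isolates g_r(T). -/
theorem HasFourier.dilation_eq (hg : HasFourier f c g) (hT : T ∈ domain f H) {r : ℝ}
    (hr : r ∈ Set.Ico (0 : ℝ) 1) :
    dilation c r T = adjoint (poissonKernel f fun i => (r : ℂ) • T i) ∘L ampliation H g ∘L
      poissonKernel f fun i => (r : ℂ) • T i := by
  rw [← ContinuousLinearMap.comp_assoc, ← hg.dilation_comp_adjoint hT hr,
    ContinuousLinearMap.comp_assoc, adjoint_comp_poissonKernel
      (smul_mem_domain hT (Set.Ico_subset_Icc_self hr)) (isPure_smul hT hr)]
  rfl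

theorem norm_conj_le {E F : Type*} [NormedAddCommGroup E] [InnerProductSpace ℂ E] [CompleteSpace E]
    [NormedAddCommGroup F] [InnerProductSpace ℂ F] [CompleteSpace F] {K : E →L[ℂ] F} (hK : ‖K‖ ≤ 1)
    (X : F →L[ℂ] F) : ‖adjoint K ∘L X ∘L K‖ ≤ ‖X‖ :=
  calc _ ≤ ‖adjoint K‖ * (‖X‖ * ‖K‖) := (ContinuousLinearMap.opNorm_comp_le _ _).trans
        (mul_le_mul_of_nonneg_left (ContinuousLinearMap.opNorm_comp_le _ _) (norm_nonneg _))
    _ ≤ 1 * (‖X‖ * 1) := by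
        gcongr
        rwa [LinearIsometryEquiv.norm_map]
    _ = ‖X‖ := by ring

theorem HasFourier.norm_dilation_le (hg : HasFourier f c g) (hT : T ∈ domain f H) {r : ℝ}
    (hr : r ∈ Set.Ico (0 : ℝ) 1) : ‖dilation c r T‖ ≤ ‖g‖ := by
  rw [hg.dilation_eq hT hr]
  exact (norm_conj_le (norm_poissonKernel_le
    (smul_mem_domain hT (Set.Ico_subset_Icc_self hr))) _).trans (norm_ampliation_le g)

end

/-! ### Radial limits of Φ, the defect operator and the Poisson kernel. -/

section

variable {n : ℕ} {H : Type*} [NormedAddCommGroup H] [InnerProductSpace ℂ H]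

theorem nonneg_of_inner {A : H →L[ℂ] H}
    (h : ∀ x, (inner ℂ x (A x)).im = 0 ∧ 0 ≤ (inner ℂ x (A x)).re) : 0 ≤ A := by
  rw [ContinuousLinearMap.nonneg_iff_isPositive, ContinuousLinearMap.isPositive_iff_complex]
  intro x
  have h1 : inner ℂ x (A x) = ((inner ℂ x (A x)).re : ℂ) := Complex.ext rfl (h x).1
  rw [← inner_conj_symm, h1, Complex.conj_ofReal]
  exact ⟨rfl, (h x).2⟩

variable [CompleteSpace H] {f : PositiveRegular n} {T : Fin n → H →L[ℂ] H}

/-- A = B² with B a contraction. For positive contractions this upgrades convergence of quadratic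
forms to zero to strong convergence. -/
theorem norm_apply_sq_le_inner {A : H →L[ℂ] H} (h0 : 0 ≤ A) (h1 : ‖A‖ ≤ 1) (x : H) :
    ‖A x‖ ^ 2 ≤ (inner ℂ x (A x)).re := by
  set B := CFC.sqrt A
  have hsq : B * B = A := CFC.sqrt_mul_sqrt_self A h0
  have hsa : adjoint B = B := (IsSelfAdjoint.of_nonneg (CFC.sqrt_nonneg A)).adjoint_eq
  have hB : ‖B‖ ≤ 1 := by
    have h2 : ‖B‖ * ‖B‖ = ‖A‖ := by
      rw [← hsq, ← CStarRing.norm_star_mul_self (x := B), ContinuousLinearMap.star_eq_adjoint, hsa]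
    nlinarith [norm_nonneg B]
  have h2 : (inner ℂ x (A x)).re = ‖B x‖ ^ 2 := by
    rw [← hsq, mul_apply_eq_comp, ← ContinuousLinearMap.adjoint_inner_left, hsa]
    exact inner_self_eq_norm_sq (𝕜 := ℂ) _
  rw [h2, ← hsq, mul_apply_eq_comp]
  exact pow_le_pow_left₀ (norm_nonneg _) (by simpa using B.le_of_opNorm_le hB (B x)) 2

theorem norm_le_one_of_nonneg_of_le_one {A : H →L[ℂ] H} (h0 : 0 ≤ A) (h1 : A ≤ 1) : ‖A‖ ≤ 1 :=
  (CStarAlgebra.norm_le_norm_of_nonneg_of_le h0 h1).trans ContinuousLinearMap.norm_id_le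

theorem phi_one_nonneg (hT : T ∈ domain f H) : 0 ≤ phi f T 1 :=
  nonneg_of_inner fun x => ⟨(hasSum_phi hT x).2, (hasSum_phi hT x).1.nonneg fun α =>
    mul_nonneg (f.coeff_nonneg α) (sq_nonneg _)⟩

theorem phi_one_le_one (hT : T ∈ domain f H) : phi f T 1 ≤ 1 := by
  refine sub_nonneg.1 (nonneg_of_inner fun x => ?_)
  have h1 : (inner ℂ x x).re = ‖x‖ ^ 2 := inner_self_eq_norm_sq (𝕜 := ℂ) x
  have h2 : (inner ℂ x x).im = 0 := inner_self_im (𝕜 := ℂ) x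
  rw [sub_apply, one_apply_eq_self, inner_sub_right, Complex.sub_im, Complex.sub_re, h1, h2,
    (hasSum_phi hT x).2]
  exact ⟨sub_zero _, sub_nonneg.2 (inner_phi_one_le hT x)⟩

theorem phi_one_smul_le (hT : T ∈ domain f H) {r : ℝ} (hr : r ∈ Set.Icc (0 : ℝ) 1) :
    phi f (fun i => (r : ℂ) • T i) 1 ≤ phi f T 1 := by
  refine sub_nonneg.1 (nonneg_of_inner fun x => ?_)
  have h1 := hasSum_phi (smul_mem_domain hT hr) x
  have h2 := hasSum_phi hT x
  rw [sub_apply, inner_sub_right, Complex.sub_im, Complex.sub_re, h1.2, h2.2]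
  refine ⟨sub_zero _, sub_nonneg.2 (hasSum_le (fun α => ?_) h1.1 h2.1)⟩
  rw [norm_adjoint_wordProd_smul hr.1]
  refine mul_le_mul_of_nonneg_left (pow_le_pow_left₀
    (mul_nonneg (pow_nonneg hr.1 _) (norm_nonneg _)) ?_ 2) (f.coeff_nonneg α)
  exact mul_le_of_le_one_left (norm_nonneg _) (pow_le_one₀ hr.1 hr.2)

theorem eventually_mem_Ico : ∀ᶠ r : ℝ in 𝓝[<] 1, r ∈ Set.Ico (0 : ℝ) 1 :=
  Filter.mem_of_superset (Ioo_mem_nhdsLT zero_lt_one) Set.Ioo_subset_Ico_self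

theorem eventually_smul_mem_domain (hT : T ∈ domain f H) :
    ∀ᶠ r : ℝ in 𝓝[<] 1, (fun i => (r : ℂ) • T i) ∈ domain f H :=
  eventually_mem_Ico.mono fun _ hr => smul_mem_domain hT (Set.Ico_subset_Icc_self hr)

theorem tendsto_pow_nhdsLT_one (k : ℕ) : Tendsto (fun r : ℝ => r ^ k) (𝓝[<] 1) (𝓝 1) := by
  have h : Tendsto (fun r : ℝ => r ^ k) (𝓝 1) (𝓝 (1 ^ k)) := (continuous_pow k).tendsto 1
  rw [one_pow] at h
  exact h.mono_left nhdsWithin_le_nhds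

/-- The quadratic forms converge by dominated convergence, with the series for T as majorant. The
difference of the two operators lies between 0 and I, so its strong convergence is controlled by its
form. -/
theorem tendsto_phi_one_smul (hT : T ∈ domain f H) (x : H) :
    Tendsto (fun r : ℝ => phi f (fun i => (r : ℂ) • T i) 1 x) (𝓝[<] 1) (𝓝 (phi f T 1 x)) := by
  have h0 := hasSum_phi hT x
  have h1 : Tendsto (fun r : ℝ => ∑' α, f.coeff α *
      ‖adjoint (wordProd (fun i => (r : ℂ) • T i) α) x‖ ^ 2) (𝓝[<] 1)
      (𝓝 (∑' α, f.coeff α * ‖adjoint (wordProd T α) x‖ ^ 2)) := by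
    refine tendsto_tsum_of_dominated_convergence h0.1.summable (fun α => ?_) ?_
    · have h2 : Tendsto (fun r : ℝ => f.coeff α *
          (r ^ α.length * ‖adjoint (wordProd T α) x‖) ^ 2) (𝓝[<] 1)
          (𝓝 (f.coeff α * (1 * ‖adjoint (wordProd T α) x‖) ^ 2)) :=
        (((tendsto_pow_nhdsLT_one _).mul_const _).pow 2).const_mul _
      rw [one_mul] at h2
      exact h2.congr' (eventually_mem_Ico.mono fun r hr => by
        simp only [norm_adjoint_wordProd_smul hr.1])
    · refine eventually_mem_Ico.mono fun r hr α => ?_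
      rw [norm_adjoint_wordProd_smul hr.1, Real.norm_eq_abs,
        abs_of_nonneg (mul_nonneg (f.coeff_nonneg α) (sq_nonneg _))]
      refine mul_le_mul_of_nonneg_left (pow_le_pow_left₀
        (mul_nonneg (pow_nonneg hr.1 _) (norm_nonneg _)) ?_ 2) (f.coeff_nonneg α)
      exact mul_le_of_le_one_left (norm_nonneg _) (pow_le_one₀ hr.1 hr.2.le)
  have h2 : Tendsto (fun r : ℝ => √((inner ℂ x (phi f T 1 x)).re - ∑' α, f.coeff α *
      ‖adjoint (wordProd (fun i => (r : ℂ) • T i) α) x‖ ^ 2)) (𝓝[<] 1) (𝓝 0) := by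
    rw [h0.1.tsum_eq] at h1
    simpa using (h1.const_sub (inner ℂ x (phi f T 1 x)).re).sqrt
  rw [tendsto_iff_norm_sub_tendsto_zero]
  refine squeeze_zero_norm' (eventually_mem_Ico.mono fun r hr => ?_) h2
  have hr' := Set.Ico_subset_Icc_self hr
  have hTr := smul_mem_domain hT hr'
  have h3 := sub_nonneg.2 (phi_one_smul_le hT hr')
  have h4 : phi f T 1 - phi f (fun i => (r : ℂ) • T i) 1 ≤ 1 :=
    (sub_le_self _ (phi_one_nonneg hTr)).trans (phi_one_le_one hT)
  have h5 := norm_apply_sq_le_inner h3 (norm_le_one_of_nonneg_of_le_one h3 h4) x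
  rw [sub_apply, inner_sub_right, Complex.sub_re, ← (hasSum_phi hTr x).1.tsum_eq] at h5
  rw [norm_norm, norm_sub_rev]
  exact Real.le_sqrt_of_sq_le h5

theorem tendsto_defect_smul (hT : T ∈ domain f H) (x : H) :
    Tendsto (fun r : ℝ => defect f (fun i => (r : ℂ) • T i) x) (𝓝[<] 1) (𝓝 (defect f T x)) := by
  have key : ∀ S : Fin n → H →L[ℂ] H, S ∈ domain f H →
      0 ≤ 1 - phi f S 1 ∧ ‖1 - phi f S 1‖ ≤ 1 := fun S hS =>
    have h := sub_nonneg.2 (phi_one_le_one hS)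
    ⟨h, norm_le_one_of_nonneg_of_le_one h (sub_le_self _ (phi_one_nonneg hS))⟩
  refine tendsto_sqrt_apply ((eventually_smul_mem_domain hT).mono fun r hr => key _ hr)
    (key T hT).1 (key T hT).2 (fun y => ?_) x
  simpa using (tendsto_phi_one_smul hT y).const_sub y

theorem eventually_norm_poissonKernel_le (hT : T ∈ domain f H) :
    ∀ᶠ r : ℝ in 𝓝[<] 1, ‖poissonKernel f fun i => (r : ℂ) • T i‖ ≤ 1 :=
  (eventually_smul_mem_domain hT).mono fun _ hr => norm_poissonKernel_le hr

/-- On e_γ ⊗ x the adjoint is √b_γ r^{|γ|} T_γ Δ_{rT} x, so strong convergence of the defects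
suffices; density and contractivity do the rest. -/
theorem tendsto_adjoint_poissonKernel_smul (hT : T ∈ domain f H) (ξ : FockTensor n H) :
    Tendsto (fun r : ℝ => adjoint (poissonKernel f fun i => (r : ℂ) • T i) ξ) (𝓝[<] 1)
      (𝓝 (adjoint (poissonKernel f T) ξ)) := by
  refine tendsto_apply_of_dense_span (C := 1) ?_ (dense_span_tensor_e n H) ?_ ξ
  · exact (eventually_norm_poissonKernel_le hT).mono fun r hr => by
      rwa [LinearIsometryEquiv.norm_map]
  · rintro _ ⟨⟨γ, x⟩, rfl⟩
    rw [adjoint_poissonKernel_tensor_e hT]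
    have h1 : Tendsto (fun r : ℝ => (r : ℂ) ^ γ.length) (𝓝[<] 1) (𝓝 1) := by
      have := (Complex.continuous_ofReal.tendsto 1).comp (tendsto_pow_nhdsLT_one γ.length)
      simpa [Function.comp_def] using this
    have h2 := (h1.smul (((wordProd T γ).continuous.tendsto _).comp
      (tendsto_defect_smul hT x))).const_smul ((√(f.b γ) : ℝ) : ℂ)
    rw [one_smul] at h2
    refine h2.congr' ((eventually_smul_mem_domain hT).mono fun r hr => ?_)
    simp only [adjoint_poissonKernel_tensor_e hr, wordProd_smul]
    rfl

/-- Both kernels are isometries, so ‖K_{rT}h - K_T h‖² = 2‖h‖² - 2 Re⟨h, K_{rT}^* K_T h⟩, which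
tends to 0 because K_{rT}^* K_T h → K_T^* K_T h = h. -/
theorem tendsto_poissonKernel_smul_of_isPure (hT : T ∈ domain f H) (hp : IsPure f T) (h : H) :
    Tendsto (fun r : ℝ => poissonKernel f (fun i => (r : ℂ) • T i) h) (𝓝[<] 1)
      (𝓝 (poissonKernel f T h)) := by
  have h1 : Tendsto (fun r : ℝ => 2 * ‖h‖ ^ 2 - 2 * (inner ℂ h
      (adjoint (poissonKernel f fun i => (r : ℂ) • T i) (poissonKernel f T h))).re) (𝓝[<] 1)
      (𝓝 0) := by
    have h2 := (Complex.continuous_re.tendsto _).comp ((tendsto_const_nhds (x := h)).inner (𝕜 := ℂ)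
      (tendsto_adjoint_poissonKernel_smul hT (poissonKernel f T h)))
    have h3 : adjoint (poissonKernel f T) (poissonKernel f T h) = h :=
      DFunLike.congr_fun (adjoint_comp_poissonKernel hT hp) h
    have h4 : (inner ℂ h h).re = ‖h‖ ^ 2 := inner_self_eq_norm_sq (𝕜 := ℂ) h
    rw [h3, h4] at h2
    have h5 := (h2.const_mul 2).const_sub (2 * ‖h‖ ^ 2)
    rwa [sub_self] at h5
  have h2 := h1.sqrt
  rw [Real.sqrt_zero] at h2
  rw [tendsto_iff_norm_sub_tendsto_zero]
  refine squeeze_zero_norm' (eventually_mem_Ico.mono fun r hr => ?_) h2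
  have hTr := smul_mem_domain hT (Set.Ico_subset_Icc_self hr)
  rw [norm_norm]
  refine Real.le_sqrt_of_sq_le (le_of_eq ?_)
  rw [norm_sub_sq (𝕜 := ℂ), norm_poissonKernel_of_isPure hT hp,
    norm_poissonKernel_of_isPure hTr (isPure_smul hT hr), ContinuousLinearMap.adjoint_inner_right]
  simp only [RCLike.re_to_complex]
  ring

end

/-! ### Operator topologies and their behaviour under ampliation. -/

section

section Topologies

variable {E : Type*} [NormedAddCommGroup E]


theorem summable_norm_sq_lp {ι : Type*} (x : lp (fun _ : ι => E) 2) :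
    Summable fun i => ‖x i‖ ^ 2 := by
  simpa using (lp.memℓp x).summable (by norm_num)

theorem memℓp_two_of_summable {ι : Type*} {x : ι → E} (h : Summable fun i => ‖x i‖ ^ 2) :
    Memℓp x 2 :=
  memℓp_gen (by simpa using h)

variable [InnerProductSpace ℂ E]

theorem tendsto_sot_iff {ι : Type*} {l : Filter ι} {A : ι → E →L[ℂ] E} {B : E →L[ℂ] E} :
    Tendsto A l (@nhds _ (sot E) B) ↔ ∀ x, Tendsto (fun i => A i x) l (𝓝 (B x)) := by
  rw [sot, nhds_induced, tendsto_comap_iff, tendsto_pi_nhds]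
  rfl

theorem tendsto_wot_iff [CompleteSpace E] {ι : Type*} {l : Filter ι} {A : ι → E →L[ℂ] E}
    {B : E →L[ℂ] E} : Tendsto A l (@nhds _ (wot E) B) ↔
      ∀ x y, Tendsto (fun i => inner ℂ y (A i x)) l (𝓝 (inner ℂ y (B x))) := by
  rw [wot, nhds_induced, tendsto_comap_iff,
    ContinuousLinearMapWOT.tendsto_iff_forall_inner_apply_tendsto]
  rfl

theorem tendsto_val_nhdsWithin_induced {X : Type*} {p : X → Prop} (t : TopologicalSpace X)
    (a : Subtype p) (s : Set (Subtype p)) :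
    Tendsto Subtype.val (@nhdsWithin _ (t.induced Subtype.val) a s) (@nhds _ t a.1) := by
  refine Tendsto.mono_left ?_ inf_le_left
  rw [nhds_induced]
  exact tendsto_comap

theorem continuous_weakStar_tsum (x y : lp (fun _ : ℕ => E) 2) :
    @Continuous _ _ (weakStar E) inferInstance
      fun A : E →L[ℂ] E => ∑' k, inner ℂ (y k) (A (x k)) :=
  continuous_iff_le_induced.2 (iInf₂_le (f := fun x y : lp (fun _ : ℕ => E) 2 =>
    TopologicalSpace.induced (fun A : E →L[ℂ] E => ∑' k, inner ℂ (y k) (A (x k))) inferInstance)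
    x y)

/-- An ℓ² family has countable support, so it can be transported to ℕ along an injection and
extended by zero. This allows w*-functionals over any index set, in particular over a basis of a
nonseparable H. -/
theorem exists_lp_nat_tsum_inner_eq {ι : Type*} (x y : lp (fun _ : ι => E) 2) :
    ∃ x' y' : lp (fun _ : ℕ => E) 2, ∀ A : E →L[ℂ] E,
      ∑' i, inner ℂ (y i) (A (x i)) = ∑' k, inner ℂ (y' k) (A (x' k)) := by
  let S : Set ι := {i | x i ≠ 0}
  have hS : S.Countable := by
    refine (summable_norm_sq_lp x).countable_support.mono fun i hi => ?_
    exact pow_ne_zero 2 (norm_ne_zero_iff.2 hi)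
  have : Countable S := hS
  obtain ⟨σ, hσ⟩ := Countable.exists_injective_nat S
  have hext : ∀ z : lp (fun _ : ι => E) 2,
      Memℓp (Function.extend σ (fun i : S => z i) 0) 2 := by
    intro z
    refine memℓp_two_of_summable ?_
    have h1 : (fun k => ‖Function.extend σ (fun i : S => z i) 0 k‖ ^ 2) =
        Function.extend σ (fun i : S => ‖z i‖ ^ 2) 0 := by
      funext k
      by_cases hk : ∃ i, σ i = k
      · obtain ⟨i, rfl⟩ := hk
        rw [hσ.extend_apply, hσ.extend_apply]
      · rw [Function.extend_apply' _ _ _ hk, Function.extend_apply' _ _ _ hk]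
        simp
    rw [h1]
    exact (summable_extend_zero hσ).2 ((summable_norm_sq_lp z).subtype S)
  refine ⟨⟨_, hext x⟩, ⟨_, hext y⟩, fun A => ?_⟩
  have h2 : (fun k => inner ℂ (Function.extend σ (fun i : S => y i) 0 k)
      (A (Function.extend σ (fun i : S => x i) 0 k))) =
      Function.extend σ (fun i : S => inner ℂ (y i) (A (x i))) 0 := by
    funext k
    by_cases hk : ∃ i, σ i = k
    · obtain ⟨i, rfl⟩ := hk
      rw [hσ.extend_apply, hσ.extend_apply, hσ.extend_apply]
    · rw [Function.extend_apply' _ _ _ hk, Function.extend_apply' _ _ _ hk,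
        Function.extend_apply' _ _ _ hk]
      simp
  change _ = ∑' k, inner ℂ (Function.extend σ (fun i : S => y i) 0 k)
      (A (Function.extend σ (fun i : S => x i) 0 k))
  rw [h2, tsum_extend_zero hσ]
  refine (tsum_subtype_eq_of_support_subset (s := S) (f := fun i => inner ℂ (y i) (A (x i)))
    fun i hi h0 => hi ?_).symm
  simp only [h0, map_zero, inner_zero_right]

end Topologies

variable {n : ℕ} {H : Type*} [NormedAddCommGroup H] [InnerProductSpace ℂ H]

theorem tendsto_ampliation {ι : Type*} {l : Filter ι} {A : ι → Fock n →L[ℂ] Fock n}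
    {B : Fock n →L[ℂ] Fock n} {C : ℝ} (hC : ∀ᶠ i in l, ‖A i‖ ≤ C)
    (h : ∀ v, Tendsto (fun i => A i v) l (𝓝 (B v))) (ξ : FockTensor n H) :
    Tendsto (fun i => ampliation H (A i) ξ) l (𝓝 (ampliation H B ξ)) := by
  refine tendsto_apply_of_dense_span (hC.mono fun i hi => (norm_ampliation_le _).trans hi)
    (dense_span_tensor_e n H) ?_ ξ
  rintro _ ⟨⟨γ, x⟩, rfl⟩
  simp only [ampliation_tensor]
  exact ((tensorRight n x).continuous.tendsto _).comp (h (e γ))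

theorem tendsto_inner_ampliation {ι : Type*} {l : Filter ι} {A : ι → Fock n →L[ℂ] Fock n}
    {B : Fock n →L[ℂ] Fock n} {C : ℝ} (hC : ∀ᶠ i in l, ‖A i‖ ≤ C)
    (h : ∀ v w, Tendsto (fun i => inner ℂ w (A i v)) l (𝓝 (inner ℂ w (B v))))
    (η ξ : FockTensor n H) :
    Tendsto (fun i => inner ℂ η (ampliation H (A i) ξ)) l (𝓝 (inner ℂ η (ampliation H B ξ))) := by
  refine tendsto_apply_of_dense_span (A := fun i => innerSL ℂ η ∘L ampliation H (A i))
    (B := innerSL ℂ η ∘L ampliation H B) (C := ‖η‖ * C) (hC.mono fun i hi => ?_)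
    (dense_span_tensor_e n H) ?_ ξ
  · refine (ContinuousLinearMap.opNorm_comp_le _ _).trans ?_
    rw [innerSL_apply_norm]
    gcongr
    exact (norm_ampliation_le _).trans hi
  · rintro _ ⟨⟨γ, x⟩, rfl⟩
    -- Slicing absorbs an arbitrary η into a vector of F², so only ξ has to be approximated by
    -- elementary tensors.
    have h1 : ∀ v : Fock n, inner ℂ η (tensor v x) = inner ℂ (slice n x η) v := fun v => by
      rw [slice, ContinuousLinearMap.adjoint_inner_left, tensorRight_apply]
    simp only [ContinuousLinearMap.comp_apply, ampliation_tensor, innerSL_apply_apply, h1]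
    exact h _ _

variable [CompleteSpace H] {f : PositiveRegular n} {T : Fin n → H →L[ℂ] H}

theorem memℓp_slice {ι : Type*} (b : HilbertBasis ι ℂ H) (Z : lp (fun _ : ℕ => FockTensor n H) 2) :
    Memℓp (fun p : ℕ × ι => slice n (b p.2) (Z p.1)) 2 := by
  refine memℓp_two_of_summable ((summable_prod_of_nonneg fun p => sq_nonneg _).2
    ⟨fun k => (hasSum_norm_slice_sq b (Z k)).summable, ?_⟩)
  simp only [(hasSum_norm_slice_sq b (Z _)).tsum_eq]
  exact summable_norm_sq_lp Z

/-- Expanding each pairing by Parseval exhibits a w*-functional of A ⊗ I as a w*-functional of A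
with double index. -/
theorem tsum_inner_ampliation {ι : Type*} (b : HilbertBasis ι ℂ H)
    (X Y : lp (fun _ : ℕ => FockTensor n H) 2) (A : Fock n →L[ℂ] Fock n) :
    ∑' k, inner ℂ (Y k) (ampliation H A (X k)) =
      ∑' p : ℕ × ι, inner ℂ (slice n (b p.2) (Y p.1)) (A (slice n (b p.2) (X p.1))) := by
  have h1 : Summable fun p : ℕ × ι =>
      inner ℂ (slice n (b p.2) (Y p.1)) (A (slice n (b p.2) (X p.1))) :=
    (lp.hasSum_inner (𝕜 := ℂ) (⟨_, memℓp_slice b Y⟩ : lp (fun _ : ℕ × ι => Fock n) 2)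
      (lp.mapCLM 2 (fun _ : ℕ × ι => A) (norm_nonneg A) (fun _ => le_rfl)
        ⟨_, memℓp_slice b X⟩)).summable
  rw [h1.tsum_prod]
  refine tsum_congr fun k => ?_
  rw [← (hasSum_inner_slice b (Y k) (ampliation H A (X k))).tsum_eq]
  simp only [slice_ampliation]

theorem continuous_tsum_inner_ampliation (X Y : lp (fun _ : ℕ => FockTensor n H) 2) :
    @Continuous _ _ (weakStar (Fock n)) inferInstance
      fun A : Fock n →L[ℂ] Fock n => ∑' k, inner ℂ (Y k) (ampliation H A (X k)) := by
  obtain ⟨w, b, -⟩ := exists_hilbertBasis ℂ H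
  obtain ⟨x, y, hxy⟩ := exists_lp_nat_tsum_inner_eq
    (⟨_, memℓp_slice b X⟩ : lp (fun _ : ℕ × w => Fock n) 2) ⟨_, memℓp_slice b Y⟩
  have h0 : (fun A : Fock n →L[ℂ] Fock n => ∑' k, inner ℂ (Y k) (ampliation H A (X k))) =
      fun A => ∑' k, inner ℂ (y k) (A (x k)) :=
    funext fun A => (tsum_inner_ampliation b X Y A).trans (hxy A)
  rw [h0]
  exact continuous_weakStar_tsum x y

/-- Replacing K_T^* ξ by K_{rT}^* ξ costs at most ‖g‖ ‖K_T^* ξ - K_{rT}^* ξ‖, which vanishes in the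
limit; the intertwining relation then gives K_{rT}^*(g ⊗ I)ξ. -/
theorem HasFourier.tendsto_dilation_adjoint {c : Word n → ℂ} {g : Fock n →L[ℂ] Fock n}
    (hg : HasFourier f c g) (hT : T ∈ domain f H) (ξ : FockTensor n H) :
    Tendsto (fun r : ℝ => dilation c r T (adjoint (poissonKernel f T) ξ)) (𝓝[<] 1)
      (𝓝 (adjoint (poissonKernel f T) (ampliation H g ξ))) := by
  have h1 := tendsto_adjoint_poissonKernel_smul hT (ampliation H g ξ)
  have h2 : Tendsto (fun r : ℝ => dilation c r T (adjoint (poissonKernel f T) ξ -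
      adjoint (poissonKernel f fun i => (r : ℂ) • T i) ξ)) (𝓝[<] 1) (𝓝 0) := by
    have h3 : Tendsto (fun r : ℝ => ‖g‖ * ‖adjoint (poissonKernel f T) ξ -
        adjoint (poissonKernel f fun i => (r : ℂ) • T i) ξ‖) (𝓝[<] 1) (𝓝 0) := by
      simpa using ((tendsto_adjoint_poissonKernel_smul hT ξ).const_sub
        (adjoint (poissonKernel f T) ξ)).norm.const_mul ‖g‖
    exact squeeze_zero_norm' (eventually_mem_Ico.mono fun r hr =>
      (dilation c r T).le_of_opNorm_le (hg.norm_dilation_le hT hr) _) h3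
  have h3 := h2.add h1
  rw [zero_add] at h3
  refine h3.congr' (eventually_mem_Ico.mono fun r hr => ?_)
  have h4 := DFunLike.congr_fun (hg.dilation_comp_adjoint hT hr) ξ
  rw [ContinuousLinearMap.comp_apply, ContinuousLinearMap.comp_apply] at h4
  rw [map_sub, h4, sub_add_cancel]

/-! ### The functional calculus and its properties. -/

section Calculus

theorem dense_span_range_adjoint (hT : T ∈ domain f H) (hc : IsCNC f T) :
    Dense (Submodule.span ℂ (Set.range (adjoint (poissonKernel f T))) : Set H) :=
  (denseRange_adjoint_poissonKernel hT hc).mono Submodule.subset_span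

theorem exists_comp_adjoint_poissonKernel_eq (hT : T ∈ domain f H) (hc : IsCNC f T)
    (g : hardyAlgebra f) :
    ∃ B : H →L[ℂ] H, B ∘L adjoint (poissonKernel f T) =
        adjoint (poissonKernel f T) ∘L ampliation H (g : Fock n →L[ℂ] Fock n) := by
  obtain ⟨c, hg⟩ := g.2
  obtain ⟨B, hB⟩ := exists_tendsto_apply_of_dense_span
    (eventually_mem_Ico.mono fun r hr => hg.norm_dilation_le hT hr)
    (dense_span_range_adjoint hT hc) (by
      rintro _ ⟨ξ, rfl⟩
      exact ⟨_, hg.tendsto_dilation_adjoint hT ξ⟩)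
  exact ⟨B, ContinuousLinearMap.ext fun ξ =>
    tendsto_nhds_unique (hB _) (hg.tendsto_dilation_adjoint hT ξ)⟩

theorem eq_of_comp_adjoint_eq (hT : T ∈ domain f H) (hc : IsCNC f T) {A B : H →L[ℂ] H}
    (h : A ∘L adjoint (poissonKernel f T) = B ∘L adjoint (poissonKernel f T)) : A = B :=
  ContinuousLinearMap.ext_on (dense_span_range_adjoint hT hc) (by
    rintro _ ⟨ξ, rfl⟩
    exact DFunLike.congr_fun h ξ)

/-- The operator `g(T)`, for `g` in the Hardy algebra and `T` completely non-coisometric. -/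
noncomputable def hardyApply (hT : T ∈ domain f H) (hc : IsCNC f T) (g : hardyAlgebra f) :
    H →L[ℂ] H := (exists_comp_adjoint_poissonKernel_eq hT hc g).choose

variable (hT : T ∈ domain f H) (hc : IsCNC f T)

theorem hardyApply_comp (g : hardyAlgebra f) :
    hardyApply hT hc g ∘L adjoint (poissonKernel f T) =
      adjoint (poissonKernel f T) ∘L ampliation H (g : Fock n →L[ℂ] Fock n) :=
  (exists_comp_adjoint_poissonKernel_eq hT hc g).choose_spec

/-- The functional calculus `g ↦ g(T)` on the Hardy algebra. -/
noncomputable def hardyCalculus : hardyAlgebra f →ₐ[ℂ] (H →L[ℂ] H) :=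
  AlgHom.ofLinearMap
    { toFun := hardyApply hT hc
      map_add' := fun g h => eq_of_comp_adjoint_eq hT hc (by
        rw [ContinuousLinearMap.add_comp, hardyApply_comp, hardyApply_comp, hardyApply_comp,
          Subalgebra.coe_add, ampliation_add, ContinuousLinearMap.comp_add])
      map_smul' := fun r g => eq_of_comp_adjoint_eq hT hc (by
        rw [RingHom.id_apply, ContinuousLinearMap.smul_comp, hardyApply_comp, hardyApply_comp,
          Subalgebra.coe_smul, ampliation_smul, ContinuousLinearMap.comp_smul]) }
    (eq_of_comp_adjoint_eq hT hc (by
      change hardyApply hT hc 1 ∘L _ = _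
      rw [hardyApply_comp, Subalgebra.coe_one, ampliation_one]
      rfl))
    fun g h => eq_of_comp_adjoint_eq hT hc (by
      change hardyApply hT hc (g * h) ∘L _ = (hardyApply hT hc g ∘L hardyApply hT hc h) ∘L _
      rw [hardyApply_comp, Subalgebra.coe_mul, ampliation_mul, ← ContinuousLinearMap.comp_assoc,
        ← hardyApply_comp hT hc g, ContinuousLinearMap.comp_assoc, ← hardyApply_comp hT hc h,
        ContinuousLinearMap.comp_assoc])

theorem hardyCalculus_adjoint (g : hardyAlgebra f) (ξ : FockTensor n H) :
    hardyCalculus hT hc g (adjoint (poissonKernel f T) ξ) =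
      adjoint (poissonKernel f T) (ampliation H (g : Fock n →L[ℂ] Fock n) ξ) :=
  DFunLike.congr_fun (hardyApply_comp hT hc g) ξ

theorem tendsto_dilation {g : hardyAlgebra f} {c : Word n → ℂ} (hg : HasFourier f c g) (h : H) :
    Tendsto (fun r : ℝ => dilation c r T h) (𝓝[<] 1) (𝓝 (hardyCalculus hT hc g h)) := by
  refine tendsto_apply_of_dense_span
    (eventually_mem_Ico.mono fun r hr => hg.norm_dilation_le hT hr)
    (dense_span_range_adjoint hT hc) ?_ h
  rintro _ ⟨ξ, rfl⟩
  rw [hardyCalculus_adjoint]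
  exact hg.tendsto_dilation_adjoint hT ξ

theorem norm_hardyCalculus_le (g : hardyAlgebra f) : ‖hardyCalculus hT hc g‖ ≤ ‖g‖ := by
  obtain ⟨c, hg⟩ := g.2
  refine ContinuousLinearMap.opNorm_le_bound _ (norm_nonneg _) fun h => ?_
  exact le_of_tendsto (tendsto_dilation hT hc hg h).norm (eventually_mem_Ico.mono fun r hr =>
    (dilation c r T).le_of_opNorm_le (hg.norm_dilation_le hT hr) h)

theorem tendsto_poissonTransform (g : hardyAlgebra f) (h : H) :
    Tendsto (fun r : ℝ => (adjoint (poissonKernel f fun i => (r : ℂ) • T i) ∘L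
      ampliation H (g : Fock n →L[ℂ] Fock n) ∘L poissonKernel f fun i => (r : ℂ) • T i) h)
      (𝓝[<] 1) (𝓝 (hardyCalculus hT hc g h)) := by
  obtain ⟨c, hg⟩ := g.2
  refine (tendsto_dilation hT hc hg h).congr' (eventually_mem_Ico.mono fun r hr => ?_)
  rw [hg.dilation_eq hT hr]

/-- Ampliation and compression by a contraction do not increase matrix norms, and a uniform bound on
matrices survives entrywise strong limits. -/
theorem norm_blockOp_hardyCalculus_le {m : ℕ} (G : Matrix (Fin m) (Fin m) (hardyAlgebra f)) :
    ‖blockOp (G.map (hardyCalculus hT hc))‖ ≤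
      ‖blockOp (G.map (fun g => (g : Fock n →L[ℂ] Fock n)))‖ :=
  norm_blockOp_le_of_tendsto (norm_nonneg _)
    (A := fun r : ℝ => ((G.map (fun g => (g : Fock n →L[ℂ] Fock n))).map (ampliation H)).map
      fun X => adjoint (poissonKernel f fun i => (r : ℂ) • T i) ∘L X ∘L
        poissonKernel f fun i => (r : ℂ) • T i)
    ((eventually_norm_poissonKernel_le hT).mono fun _ hr =>
      (norm_blockOp_conj_le hr _).trans (norm_blockOp_ampliation_le _))
    fun i j x => tendsto_poissonTransform hT hc (G i j) x

theorem continuousOn_sot_hardyCalculus {B : Set (hardyAlgebra f)} (hB : Bornology.IsBounded B) :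
    @ContinuousOn _ _ ((sot (Fock n)).induced Subtype.val) (sot H) (hardyCalculus hT hc) B := by
  obtain ⟨C, hC⟩ := hB.exists_norm_le
  intro g hg
  have h1 := tendsto_sot_iff.1 (tendsto_val_nhdsWithin_induced (sot (Fock n)) g B)
  have h2 : ∀ᶠ g' : hardyAlgebra f in
      @nhdsWithin _ ((sot (Fock n)).induced Subtype.val) g B, ‖g'‖ ≤ C :=
    Filter.mem_of_superset (mem_inf_of_right (mem_principal_self B)) hC
  refine tendsto_sot_iff.2 fun h => tendsto_apply_of_dense_span
    (h2.mono fun g' hg' => (norm_hardyCalculus_le hT hc g').trans hg')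
    (dense_span_range_adjoint hT hc) ?_ h
  rintro _ ⟨ξ, rfl⟩
  simp only [hardyCalculus_adjoint]
  exact ((adjoint (poissonKernel f T)).continuous.tendsto _).comp (tendsto_ampliation h2 h1 ξ)

theorem continuousOn_wot_hardyCalculus {B : Set (hardyAlgebra f)} (hB : Bornology.IsBounded B) :
    @ContinuousOn _ _ ((wot (Fock n)).induced Subtype.val) (wot H) (hardyCalculus hT hc) B := by
  obtain ⟨C, hC⟩ := hB.exists_norm_le
  intro g hg
  have h1 := tendsto_wot_iff.1 (tendsto_val_nhdsWithin_induced (wot (Fock n)) g B)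
  have h2 : ∀ᶠ g' : hardyAlgebra f in
      -- Restricting to `B` supplies the uniform norm bound that the density argument needs.
      @nhdsWithin _ ((wot (Fock n)).induced Subtype.val) g B, ‖g'‖ ≤ C :=
    Filter.mem_of_superset (mem_inf_of_right (mem_principal_self B)) hC
  refine tendsto_wot_iff.2 fun h k => tendsto_apply_of_dense_span
    (A := fun g' => innerSL ℂ k ∘L hardyCalculus hT hc g')
    (B := innerSL ℂ k ∘L hardyCalculus hT hc g) (C := ‖k‖ * C) (h2.mono fun g' hg' => ?_)
    (dense_span_range_adjoint hT hc) ?_ h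
  · refine (ContinuousLinearMap.opNorm_comp_le _ _).trans ?_
    rw [innerSL_apply_norm]
    gcongr
    exact (norm_hardyCalculus_le hT hc g').trans hg'
  · rintro _ ⟨ξ, rfl⟩
    simp only [ContinuousLinearMap.comp_apply, innerSL_apply_apply, hardyCalculus_adjoint,
      ContinuousLinearMap.adjoint_inner_right]
    exact tendsto_inner_ampliation h2 h1 _ ξ

theorem hardyCalculus_eq_of_isPure (hp : IsPure f T) (g : hardyAlgebra f) :
    hardyCalculus hT hc g = adjoint (poissonKernel f T) ∘L
      ampliation H (g : Fock n →L[ℂ] Fock n) ∘L poissonKernel f T := by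
  ext h
  have h1 : adjoint (poissonKernel f T) (poissonKernel f T h) = h :=
    DFunLike.congr_fun (adjoint_comp_poissonKernel hT hp) h
  conv_lhs => rw [← h1]
  exact hardyCalculus_adjoint hT hc g _

theorem continuous_weakStar_hardyCalculus (hp : IsPure f T) :
    @Continuous _ _ ((weakStar (Fock n)).induced Subtype.val) (weakStar H)
      (hardyCalculus hT hc) := by
  refine continuous_iInf_rng.2 fun x => continuous_iInf_rng.2 fun y => continuous_induced_rng.2 ?_
  -- Moving K_T onto the test vectors keeps them square summable and turns a w*-functional of g(T)
  -- into one of g ⊗ I.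
  let K := lp.mapCLM 2 (fun _ : ℕ => poissonKernel f T) (norm_nonneg _) (fun _ => le_rfl)
  have h1 := @Continuous.comp _ _ _ ((weakStar (Fock n)).induced Subtype.val) (weakStar (Fock n))
    inferInstance (Subtype.val : hardyAlgebra f → _) _
    (continuous_tsum_inner_ampliation (K x) (K y))
    (@continuous_induced_dom (hardyAlgebra f) _ Subtype.val (weakStar (Fock n)))
  have h2 : (fun g : hardyAlgebra f => ∑' k, inner ℂ (y k) (hardyCalculus hT hc g (x k))) =
      fun g : hardyAlgebra f => ∑' k, inner ℂ (K y k)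
        (ampliation H (g : Fock n →L[ℂ] Fock n) (K x k)) := by
    funext g
    refine tsum_congr fun k => ?_
    rw [hardyCalculus_eq_of_isPure hT hc hp, ContinuousLinearMap.comp_apply,
      ContinuousLinearMap.adjoint_inner_right]
    rfl
  change @Continuous _ _ ((weakStar (Fock n)).induced Subtype.val) inferInstance
    fun g : hardyAlgebra f => ∑' k, inner ℂ (y k) (hardyCalculus hT hc g (x k))
  rw [h2]
  exact h1

/-- The adjoint is K_{rT}^*(g ⊗ I)^* K_{rT}. Strong convergence of the rightmost factor K_{rT} is
where purity is needed. -/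
theorem tendsto_adjoint_dilation (hp : IsPure f T) {g : hardyAlgebra f} {c : Word n → ℂ}
    (hg : HasFourier f c g) (h : H) :
    Tendsto (fun r : ℝ => adjoint (dilation c r T) h) (𝓝[<] 1)
      (𝓝 (adjoint (hardyCalculus hT hc g) h)) := by
  rw [hardyCalculus_eq_of_isPure hT hc hp]
  have h1 : ∀ S : Fin n → H →L[ℂ] H, adjoint (adjoint (poissonKernel f S) ∘L
      ampliation H (g : Fock n →L[ℂ] Fock n) ∘L poissonKernel f S) h =
      adjoint (poissonKernel f S) (adjoint (ampliation H (g : Fock n →L[ℂ] Fock n))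
        (poissonKernel f S h)) := fun S => by
    rw [ContinuousLinearMap.adjoint_comp, ContinuousLinearMap.adjoint_comp,
      ContinuousLinearMap.adjoint_adjoint]
    rfl
  rw [h1]
  have h2 := tendsto_apply_apply (C := 1)
    (A := fun r : ℝ => adjoint (poissonKernel f fun i => (r : ℂ) • T i))
    ((eventually_norm_poissonKernel_le hT).mono fun r hr => by rwa [LinearIsometryEquiv.norm_map])
    (tendsto_adjoint_poissonKernel_smul hT _)
    (((adjoint (ampliation H (g : Fock n →L[ℂ] Fock n))).continuous.tendsto _).comp
      (tendsto_poissonKernel_smul_of_isPure hT hp h))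
  refine h2.congr' (eventually_mem_Ico.mono fun r hr => ?_)
  simp only [hg.dilation_eq hT hr, h1]
  rfl

end Calculus

end

end NCDomain

theorem mainTheorem2 {n : ℕ} (hn : 1 ≤ n) (f : NCDomain.PositiveRegular n)
    {H : Type*} [NormedAddCommGroup H] [InnerProductSpace ℂ H] [CompleteSpace H]
    (T : Fin n → H →L[ℂ] H) (hT : T ∈ NCDomain.domain f H) (hcnc : NCDomain.IsCNC f T) :
    ∃ Φ : NCDomain.hardyAlgebra f →ₐ[ℂ] (H →L[ℂ] H),
      -- `g_r(T)` is given by a norm convergent series and `Φ(g) = SOT-lim g_r(T)`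
      (∀ (g : NCDomain.hardyAlgebra f) (c : NCDomain.Word n → ℂ), NCDomain.HasFourier f c g →
        (∀ r ∈ Set.Ico (0 : ℝ) 1, Summable fun k : ℕ => ∑ α : Fin k → Fin n,
          (c (NCDomain.wordOf α) * (r : ℂ) ^ k) • NCDomain.wordProd T (NCDomain.wordOf α)) ∧
        ∀ h : H, Tendsto (fun r : ℝ => NCDomain.dilation c r T h) (𝓝[<] 1) (𝓝 (Φ g h))) ∧
      -- WOT-continuity and SOT-continuity on bounded sets
      (∀ B : Set (NCDomain.hardyAlgebra f), Bornology.IsBounded B →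
        @ContinuousOn _ _ ((NCDomain.wot (NCDomain.Fock n)).induced Subtype.val)
          (NCDomain.wot H) Φ B ∧
        @ContinuousOn _ _ ((NCDomain.sot (NCDomain.Fock n)).induced Subtype.val)
          (NCDomain.sot H) Φ B) ∧
      -- complete contractivity
      (∀ (m : ℕ) (G : Matrix (Fin m) (Fin m) (NCDomain.hardyAlgebra f)),
        ‖NCDomain.blockOp (G.map Φ)‖ ≤
          ‖NCDomain.blockOp (G.map (fun g => (g : NCDomain.Fock n →L[ℂ] NCDomain.Fock n)))‖) ∧
      -- `Φ` coincides with the Poisson transform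
      (∀ (g : NCDomain.hardyAlgebra f) (h : H), Tendsto (fun r : ℝ =>
        (ContinuousLinearMap.adjoint (NCDomain.poissonKernel f fun i => (r : ℂ) • T i) ∘L
          NCDomain.ampliation H (g : NCDomain.Fock n →L[ℂ] NCDomain.Fock n) ∘L
          NCDomain.poissonKernel f fun i => (r : ℂ) • T i) h) (𝓝[<] 1) (𝓝 (Φ g h))) ∧
      -- the pure case
      (NCDomain.IsPure f T →
        (∀ g : NCDomain.hardyAlgebra f, Φ g =
          ContinuousLinearMap.adjoint (NCDomain.poissonKernel f T) ∘L
            NCDomain.ampliation H (g : NCDomain.Fock n →L[ℂ] NCDomain.Fock n) ∘L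
            NCDomain.poissonKernel f T) ∧
        @Continuous _ _ ((NCDomain.weakStar (NCDomain.Fock n)).induced Subtype.val)
          (NCDomain.weakStar H) Φ ∧
        ∀ (g : NCDomain.hardyAlgebra f) (c : NCDomain.Word n → ℂ), NCDomain.HasFourier f c g →
          ∀ h : H, Tendsto
            (fun r : ℝ => ContinuousLinearMap.adjoint (NCDomain.dilation c r T) h) (𝓝[<] 1)
            (𝓝 (ContinuousLinearMap.adjoint (Φ g) h))) := by
  exact ⟨NCDomain.hardyCalculus hT hcnc,
    fun g c hg => ⟨fun r hr => NCDomain.summable_dilation hT hg.1 hr,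
      NCDomain.tendsto_dilation hT hcnc hg⟩,
    fun B hB => ⟨NCDomain.continuousOn_wot_hardyCalculus hT hcnc hB,
      NCDomain.continuousOn_sot_hardyCalculus hT hcnc hB⟩,
    fun m G => NCDomain.norm_blockOp_hardyCalculus_le hT hcnc G,
    NCDomain.tendsto_poissonTransform hT hcnc,
    fun hp => ⟨NCDomain.hardyCalculus_eq_of_isPure hT hcnc hp,
      NCDomain.continuous_weakStar_hardyCalculus hT hcnc hp,
      fun g c hg => NCDomain.tendsto_adjoint_dilation hT hcnc hp hg⟩⟩
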